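/- Let $X\subset\mathbb R^n$ be a Delone set, i.e. there are $r,R>0$ such that every open ball of radius $r$ contains at most one point of $X$ and every closed ball of radius $R$ contains at least one point of $X$. Suppose that $X$ is of finite type, i.e. $(X-X)\cap K$ is finite for every bounded $K\subset\mathbb R^n$, and that $0\in X$. For $x\in X$ and $T>0$ the $T$-patch of $X$ centred at $x$ is the set of points of $X$ at distance at most $T$ from $x$. Let $N_X(T)$ be the number of $T$-patches of $X$ up to translation, where patches are translated so that their centres go to $0$. The set $X$ is repetitive if for every $T>0$ there is a finite $M>0$ such that every closed ball of radius $M$ contains, for each $T$-patch $P$ of $X$, a point of $X$ whose $T$-patch is the translate of $P$ (centre to centre); $M_X(T)$ denotes the least such $M$. A repetitive Delone set of finite type is linearly repetitive if $M_X(T)=O(T)$ as $T\to\infty$, and densely repetitive if $M_X(T)=O(N_X(T)^{1/n})$ as $T\to\infty$. Let $[X]$ be the additive subgroup of $\mathbb R^n$ generated by $X$. The address map $\varphi:[X]\to\mathbb Z^s$ associated to a $\mathbb Z$-basis $y_1,\dots,y_s$ of $[X]$ is the isomorphism $\varphi(n_1y_1+\dots+n_sy_s)=(n_1,\dots,n_s)$.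 All norms are Euclidean. **Theorem.** Suppose that $X$ is linearly repetitive or densely repetitive. Then for every address map $\varphi:[X]\to\mathbb Z^s$ there is a unique linear map $L:\mathbb R^n\to\mathbb R^s$ such that $$\|\varphi(x)-L(x)\|=o(\|x\|)\qquad (x\in X,\ \|x\|\to\infty).$$ If $X$ is linearly repetitive, then there is $\delta=\delta(X)\in(0,1)$, depending only on $X$, such that for every address map $\varphi$ the corresponding $L$ satisfies $$\|\varphi(x)-L(x)\|=O(\|x\|^{1-\delta})\qquad (x\in X).$$ -/

import Mathlib

open scoped Pointwise
open Filter Asymptotics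

namespace Delone

section Sets

variable {E : Type*} [NormedAddCommGroup E]

/-- `X` is a Delone set of finite type: it is uniformly discrete and relatively dense (with some
radii), and `X - X` is locally finite. -/
def IsFiniteType (X : Set E) : Prop :=
  (∃ D : DeloneSet E, (D : Set E) = X) ∧
    ∀ K : Set E, Bornology.IsBounded K → ((X - X) ∩ K).Finite

/-- The `T`-patch of `X` centred at `x`, translated to the origin:
`{y - x | y ∈ X, ‖y - x‖ ≤ T}`. -/
def centredPatch (X : Set E) (x : E) (T : ℝ) : Set E :=
  (fun y => y - x) '' (X ∩ Metric.closedBall x T)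

/-- The `T`-atlas of `X`: all `T`-patches of `X` centred at points of `X`, translated to the
origin. -/
def atlas (X : Set E) (T : ℝ) : Set (Set E) :=
  {P | ∃ x ∈ X, P = centredPatch X x T}

/-- The patch-counting function `N_X(T)` (the atlas is finite when `X` is of finite type). -/
noncomputable def patchCount (X : Set E) (T : ℝ) : ℕ :=
  (atlas X T).ncard

/-- Every closed ball of radius `M` contains, for each `T`-patch of `X`, a point of `X` that is the
centre of a translate of that patch. -/
def IsRepetitivityRadius (X : Set E) (T M : ℝ) : Prop :=
  ∀ c : E, ∀ P ∈ atlas X T, ∃ y ∈ X ∩ Metric.closedBall c M, centredPatch X y T = P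

/-- `X` is repetitive: a finite repetitivity radius exists for every `T > 0`. -/
def IsRepetitive (X : Set E) : Prop :=
  ∀ T : ℝ, 0 < T → ∃ M : ℝ, 0 < M ∧ IsRepetitivityRadius X T M

/-- The repetitivity function `M_X(T)`: the least repetitivity radius. -/
noncomputable def repetitivity (X : Set E) (T : ℝ) : ℝ :=
  sInf {M : ℝ | 0 < M ∧ IsRepetitivityRadius X T M}

/-- A repetitive Delone set of finite type with `M_X(T) = O(T)` as `T → ∞`. -/
def IsLinearlyRepetitive (X : Set E) : Prop :=
  IsFiniteType X ∧ IsRepetitive X ∧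
    (fun T : ℝ => repetitivity X T) =O[atTop] fun T : ℝ => T

/-- A repetitive Delone set of finite type in `ℝⁿ` with `M_X(T) = O(N_X(T)^{1/n})` as `T → ∞`. -/
def IsDenselyRepetitive {n : ℕ} (X : Set (EuclideanSpace ℝ (Fin n))) : Prop :=
  IsFiniteType X ∧ IsRepetitive X ∧
    (fun T : ℝ => repetitivity X T) =O[atTop]
      fun T : ℝ => (patchCount X T : ℝ) ^ (1 / (n : ℝ))

/-- The address map `[X] → ℤˢ` of a `ℤ`-basis `y₁, …, yₛ` of the additive group `[X]` generated by
`X`: it sends `n₁ y₁ + ⋯ + nₛ yₛ` to `(n₁, …, nₛ)`. -/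
noncomputable def addressMap {X : Set E} {s : ℕ}
    (b : Module.Basis (Fin s) ℤ (AddSubgroup.closure X)) :
    AddSubgroup.closure X ≃+ (Fin s → ℤ) :=
  b.equivFun.toAddEquiv

/-- The address `φ(x)` of a point `x ∈ X`, regarded as a vector of `ℝˢ` with its Euclidean norm. -/
noncomputable def address {X : Set E} {s : ℕ}
    (φ : AddSubgroup.closure X ≃+ (Fin s → ℤ)) (x : X) : EuclideanSpace ℝ (Fin s) :=
  WithLp.toLp 2 fun i => (φ ⟨x.1, AddSubgroup.subset_closure x.2⟩ i : ℝ)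

/-- The real-linear map `L` satisfies `‖φ(x) - L(x)‖ = o(‖x‖)` as `‖x‖ → ∞`, `x ∈ X`. -/
def IsAsymptoticLinearMap [Module ℝ E] {X : Set E} {s : ℕ}
    (φ : AddSubgroup.closure X ≃+ (Fin s → ℤ)) (L : E →ₗ[ℝ] EuclideanSpace ℝ (Fin s)) : Prop :=
  (fun x : X => ‖address φ x - L x.1‖) =o[comap (fun x : X => ‖x.1‖) atTop]
    fun x : X => ‖x.1‖

end Sets

end Delone

/-!
The coordinates of an address map are additive functions `f` on `[X]`. Reading off `f` at a point of
`X` close to `p` extends `f` to a function `F` on the whole space (`IsCoarseExtension`) which is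
Lipschitz at large scale, and whose increments around a point of `X` are determined, up to a
constant, by the patch at that point. By a construction of Hyers
(`exists_linearMap_of_oscBound`), `F` is within `o(‖v‖)` of a linear map as soon as its increments
`F (p + v) - F p` and `F (q + v) - F q` always differ by `o(‖v‖)`, and the approximation is as good
as this oscillation (`OscBound`). So everything rests on estimating the oscillation.

For linearly repetitive sets there is a number `N`, depending only on `X`, such that an oscillation
`Ω` at scale `t` gives an oscillation at most `(N - 1) Ω + O(1)` at scale `N t`, whereas
subadditivity alone would give `N Ω` (`scaleOscBound_contract`). Iteration turns this into a bound
`O(‖v‖ ^ γ)` with `γ = log (N - 1) / log N`. The contraction comes from the pigeonhole principle: along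
a line on which all pieces have nearly maximal increments, copies of one piece with minimal increment
occur at bounded relative distance, and sufficiently many of these copies lie close to a common
parallel line.

For densely repetitive sets, let `σ` be the maximal and `-τ` the minimal asymptotic slope of `F` in
some direction, and suppose that `σ + τ > 0`. For a suitable length `U`, each patch of a slightly larger
radius `T` has a slope over the length `U`, which is below or above the mean of `σ` and `-τ`; one of
the two kinds, say the lower, makes up at least half of the patches. All of them occur in every ball
of radius `M_X(T)`, whose volume is `O(N_X(T))`; so the lower slopes occupy a positive proportion of
space, independent of `U`, which keeps the average slope along every long tube of parallel lines
below `σ` by a definite amount (`slope_gap_le`). This contradicts the choice of `σ`.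
-/

namespace Delone

/-! ### Oscillation of increments and Hyers' theorem -/

section Increments

variable {E : Type*} [NormedAddCommGroup E]

/-- The increments `F (p + v) - F p` of `F` along the vector `v` differ from each other by at most
`ω`, whatever the base points. -/
def OscBound (F : E → ℝ) (v : E) (ω : ℝ) : Prop :=
  ∀ p q, (F (p + v) - F p) - (F (q + v) - F q) ≤ ω

/-- The increments of `F` along any fixed vector of norm at most `t` oscillate by at most `ω`. -/
def ScaleOscBound (F : E → ℝ) (t ω : ℝ) : Prop :=
  ∀ v, ‖v‖ ≤ t → OscBound F v ω

section Oscillation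

variable {F : E → ℝ} {v w : E} {a b : ℝ}

lemma OscBound.mono (h : OscBound F v a) (hab : a ≤ b) : OscBound F v b :=
  fun p q => (h p q).trans hab

lemma OscBound.nonneg (h : OscBound F v a) : 0 ≤ a := by
  simpa using h 0 0

lemma OscBound.abs_sub_le_osc (h : OscBound F v a) (p q : E) :
    |(F (p + v) - F p) - (F (q + v) - F q)| ≤ a := by
  rw [abs_le]
  constructor
  · linarith [h q p]
  · exact h p q

lemma oscBound_zero (F : E → ℝ) : OscBound F 0 0 := fun p q => by simp

lemma OscBound.add (hv : OscBound F v a) (hw : OscBound F w b) :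
    OscBound F (v + w) (a + b) := by
  intro p q
  have h1 := hv p q
  have h2 := hw (p + v) (q + v)
  rw [← add_assoc, ← add_assoc]
  linarith

lemma OscBound.neg (hv : OscBound F v a) : OscBound F (-v) a := by
  intro p q
  have := hv (q + -v) (p + -v)
  rw [neg_add_cancel_right, neg_add_cancel_right] at this
  linarith

lemma OscBound.nsmul (hv : OscBound F v a) (k : ℕ) : OscBound F (k • v) (k * a) := by
  induction k with
  | zero => simpa using oscBound_zero F
  | succ k ih =>
    rw [succ_nsmul]
    convert ih.add hv using 1
    push_cast
    ring

lemma OscBound.sum {ι : Type*} (s : Finset ι) {V : ι → E} {c : ι → ℝ}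
    (h : ∀ i ∈ s, OscBound F (V i) (c i)) : OscBound F (∑ i ∈ s, V i) (∑ i ∈ s, c i) := by
  classical
  induction s using Finset.induction_on with
  | empty => simpa using oscBound_zero F
  | insert i s hi ih =>
    rw [Finset.sum_insert hi, Finset.sum_insert hi]
    exact (h i (by simp)).add (ih fun j hj => h j (by simp [hj]))

lemma sum_increments (F : E → ℝ) (p w : E) (N : ℕ) :
    ∑ j ∈ Finset.range N, (F (p + j • w + w) - F (p + j • w)) = F (p + N • w) - F p := by
  have := Finset.sum_range_sub (fun j : ℕ => F (p + j • w)) N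
  simp only [succ_nsmul, ← add_assoc, zero_nsmul, add_zero] at this
  exact this

end Oscillation

section Linear

variable [NormedSpace ℝ E] {F : E → ℝ}

lemma ScaleOscBound.nsmul {t ω : ℝ} (h : ScaleOscBound F t ω) (k : ℕ) :
    ScaleOscBound F (k * t) (k * ω) := by
  intro v hv
  rcases Nat.eq_zero_or_pos k with rfl | hk
  · have : v = 0 := by simpa using hv
    subst this
    simpa using oscBound_zero F
  · have hk' : (0 : ℝ) < k := by exact_mod_cast hk
    have h1 : ‖(k : ℝ)⁻¹ • v‖ ≤ t := by
      rw [norm_smul, norm_inv, Real.norm_natCast, inv_mul_le_iff₀ hk']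
      exact hv
    have := (h _ h1).nsmul k
    rwa [← Nat.cast_smul_eq_nsmul ℝ, smul_smul, mul_inv_cancel₀ hk'.ne', one_smul] at this

/-- Hyers' construction: if the increments of `F` along `v` oscillate by `o(‖v‖)`, then
`L v = lim F (m v) / m` is linear, and it approximates `F v - F 0` as well as the increments of
`F` along `v` agree with each other. -/
lemma exists_linearMap_of_oscBound {A : ℝ}
    (hF : ∀ p q, |F p - F q| ≤ A * (‖p - q‖ + 1))
    (hosc : ∀ ε > 0, ∃ C, ∀ v, OscBound F v (ε * ‖v‖ + C)) :
    ∃ L : E →ₗ[ℝ] ℝ, ∀ v ω, OscBound F v ω → |F v - F 0 - L v| ≤ ω := by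
  set h : E → ℝ := fun v => F v - F 0 with hh
  -- multiples of `v` are additive up to the oscillation
  have hmul : ∀ (v : E) (ω : ℝ), OscBound F v ω → ∀ k : ℕ, |h (k • v) - k * h v| ≤ k * ω := by
    intro v ω hv k
    have h1 := sum_increments F 0 v k
    simp only [zero_add] at h1
    have h2 : h (k • v) - k * h v
        = ∑ j ∈ Finset.range k, ((F (j • v + v) - F (j • v)) - (F (0 + v) - F 0)) := by
      rw [Finset.sum_sub_distrib, h1]
      simp [hh, mul_sub]
    rw [h2]
    refine (Finset.abs_sum_le_sum_abs _ _).trans ?_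
    refine (Finset.sum_le_sum fun j _ => hv.abs_sub_le_osc _ _).trans ?_
    simp
  have hdiv : ∀ (v : E) (ω : ℝ), OscBound F v ω → ∀ k : ℕ, 0 < k →
      |h (k • v) / k - h v| ≤ ω := by
    intro v ω hv k hk
    have hk' : (0 : ℝ) < k := by exact_mod_cast hk
    have : h (k • v) / k - h v = (h (k • v) - k * h v) / k := by field_simp
    rw [this, abs_div, abs_of_pos hk', div_le_iff₀ hk', mul_comm ω]
    exact hmul v ω hv k
  have hcau : ∀ v : E, CauchySeq fun k : ℕ => h (k • v) / k := by
    intro v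
    rw [Metric.cauchySeq_iff']
    intro ε hε
    obtain ⟨C, hC⟩ := hosc (ε / (4 * (‖v‖ + 1))) (by positivity)
    have hC0 : 0 ≤ C := by simpa using (hC 0).nonneg
    -- the scaled oscillation of a far multiple is small
    have key : ∀ m k : ℕ, 0 < m → 0 < k →
        |h ((k * m) • v) / (k * m) - h (m • v) / m| ≤ ε / 4 + C / m := by
      intro m k hm hk
      have hm' : (0 : ℝ) < m := by exact_mod_cast hm
      have hk' : (0 : ℝ) < k := by exact_mod_cast hk
      have h1 := hdiv _ _ (hC (m • v)) k hk
      rw [← mul_nsmul', ] at h1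
      have h2 : h ((k * m) • v) / (k * m) - h (m • v) / m
          = (h ((k * m) • v) / k - h (m • v)) / m := by field_simp
      rw [h2, abs_div, abs_of_pos hm', div_le_iff₀ hm']
      refine h1.trans ?_
      rw [add_mul, div_mul_cancel₀ _ hm'.ne']
      have h3 : ‖m • v‖ = m * ‖v‖ := by
        rw [← Nat.cast_smul_eq_nsmul ℝ, norm_smul, Real.norm_natCast]
      rw [h3]
      have h4 : ε / (4 * (‖v‖ + 1)) * (m * ‖v‖) = ε / 4 * m * (‖v‖ / (‖v‖ + 1)) := by
        field_simp
      have h5 : ‖v‖ / (‖v‖ + 1) ≤ 1 := by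
        rw [div_le_one (by positivity)]
        linarith
      rw [h4]
      have h6 : ε / 4 * m * (‖v‖ / (‖v‖ + 1)) ≤ ε / 4 * m * 1 := by gcongr
      linarith
    obtain ⟨m, hm⟩ := exists_nat_gt (8 * C / ε)
    have hm0 : (0 : ℝ) < m + 1 := by positivity
    have hCm : ∀ k : ℕ, m + 1 ≤ k → C / k < ε / 8 := by
      intro k hk
      have hk' : ((m : ℝ) + 1) ≤ k := by exact_mod_cast hk
      rw [div_lt_iff₀ (by linarith)]
      rw [div_lt_iff₀ hε] at hm
      nlinarith
    refine ⟨m + 1, fun k hk => ?_⟩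
    have hk0 : 0 < k := by omega
    have e1 := key (m + 1) k (by omega) hk0
    have e2 := key k (m + 1) hk0 (by omega)
    rw [mul_comm (m + 1) k] at e2
    rw [mul_comm ((m + 1 : ℕ) : ℝ) (k : ℝ)] at e2
    have e3 := hCm k hk
    have e4 := hCm (m + 1) le_rfl
    rw [Real.dist_eq]
    rw [abs_le] at e1 e2
    rw [abs_lt]
    constructor <;> linarith [e1.1, e1.2, e2.1, e2.2]
  choose L hL using fun v => cauchySeq_tendsto_of_complete (hcau v)
  have happ : ∀ v ω, OscBound F v ω → |F v - F 0 - L v| ≤ ω := by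
    intro v ω hv
    have h1 : Tendsto (fun k : ℕ => |h (k • v) / k - h v|) atTop (nhds |L v - h v|) :=
      ((hL v).sub_const _).abs
    rw [abs_sub_comm]
    refine le_of_tendsto h1 ?_
    filter_upwards [eventually_gt_atTop 0] with k hk
    exact hdiv v ω hv k hk
  have hadd : ∀ v w, L (v + w) = L v + L w := by
    intro v w
    have h1 : Tendsto (fun k : ℕ => h (k • (v + w)) / k - (h (k • v) / k + h (k • w) / k))
        atTop (nhds (L (v + w) - (L v + L w))) := (hL _).sub ((hL v).add (hL w))
    have h0 : ∀ ε > 0, |L (v + w) - (L v + L w)| ≤ ε * ‖w‖ := by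
      intro ε hε
      obtain ⟨C, hC⟩ := hosc ε hε
      have h2 : Tendsto (fun k : ℕ => ε * ‖w‖ + C / (k : ℝ)) atTop (nhds (ε * ‖w‖ + 0)) :=
        tendsto_const_nhds.add (tendsto_const_div_atTop_nhds_zero_nat C)
      rw [add_zero] at h2
      refine le_of_tendsto_of_tendsto h1.abs h2 ?_
      filter_upwards [eventually_gt_atTop 0] with k hk
      have hk' : (0 : ℝ) < k := by exact_mod_cast hk
      have h3 : h (k • (v + w)) / k - (h (k • v) / k + h (k • w) / k)
          = ((F (k • v + k • w) - F (k • v)) - (F (0 + k • w) - F 0)) / k := by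
        rw [smul_add, zero_add]
        simp only [hh]
        ring
      rw [h3, abs_div, abs_of_pos hk', div_le_iff₀ hk']
      refine ((hC (k • w)).abs_sub_le_osc _ _).trans ?_
      rw [← Nat.cast_smul_eq_nsmul ℝ, norm_smul, Real.norm_natCast, add_mul,
        div_mul_cancel₀ _ hk'.ne']
      linarith
    have h4 : |L (v + w) - (L v + L w)| ≤ 0 := by
      refine le_of_forall_pos_le_add fun ε hε => ?_
      refine (h0 (ε / (‖w‖ + 1)) (by positivity)).trans ?_
      rw [div_mul_eq_mul_div, div_le_iff₀ (by positivity)]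
      nlinarith [norm_nonneg w]
    have := abs_nonpos_iff.1 h4
    linarith
  let Lh : E →+ ℝ := AddMonoidHom.mk' L hadd
  have hcont : Continuous Lh := by
    refine Lh.continuous_of_isBounded_nhds_zero (Metric.ball_mem_nhds 0 one_pos) ?_
    obtain ⟨C, hC⟩ := hosc 1 one_pos
    rw [isBounded_iff_forall_norm_le]
    refine ⟨1 * 1 + C + A * (1 + 1), ?_⟩
    rintro _ ⟨v, hv, rfl⟩
    have hv1 : ‖v‖ ≤ 1 := (mem_ball_zero_iff.1 hv).le
    have h1 := happ v _ (hC v)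
    have h2 := hF v 0
    rw [sub_zero] at h2
    have hA : 0 ≤ A := by
      have := hF 0 0
      simp at this
      exact this
    have h3 : A * (‖v‖ + 1) ≤ A * (1 + 1) := by gcongr
    change |L v| ≤ _
    have h5 : 1 * ‖v‖ ≤ 1 * 1 := by linarith
    rw [abs_le] at h1 h2 ⊢
    constructor <;> linarith [h1.1, h1.2, h2.1, h2.2]
  exact ⟨(Lh.toRealLinearMap hcont : E →ₗ[ℝ] ℝ), happ⟩

end Linear

end Increments

/-! ### Power saving from recurrence at linear distance -/

section Contraction

variable {E : Type*} [NormedAddCommGroup E]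
variable [NormedSpace ℝ E] {F : E → ℝ}

/-- Scale-invariant pigeonhole principle: among `κ * m` points of a ball of radius `r t`, some `m`
lie within `t` of one of them. -/
lemma exists_cluster [FiniteDimensional ℝ E] (r : ℝ) :
    ∃ κ : ℕ, 0 < κ ∧ ∀ (m : ℕ) (t : ℝ) (ζ : ℕ → E), 0 < m → 0 < t →
      (∀ j < κ * m, ‖ζ j‖ ≤ r * t) →
      ∃ j₀ < κ * m, ∃ J ⊆ Finset.range (κ * m), J.card = m ∧ ∀ j ∈ J, ‖ζ j - ζ j₀‖ ≤ t := by
  classical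
  have hc : IsCompact (Metric.closedBall (0 : E) r) := isCompact_closedBall 0 r
  obtain ⟨S, -, hSfin, hS⟩ := hc.finite_cover_balls (e := 1 / 2) (by norm_num)
  lift S to Finset E using hSfin
  -- one more cell keeps the number of cells positive
  refine ⟨S.card + 1, by omega, fun m t ζ hm ht hζ => ?_⟩
  have hmem : ∀ j ∈ Finset.range ((S.card + 1) * m), ∃ s ∈ S, ‖t⁻¹ • ζ j - s‖ ≤ 1 / 2 := by
    intro j hj
    have h1 : t⁻¹ • ζ j ∈ Metric.closedBall (0 : E) r := by
      rw [mem_closedBall_zero_iff, norm_smul, norm_inv, Real.norm_of_nonneg ht.le,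
        inv_mul_le_iff₀ ht, mul_comm t]
      exact hζ j (Finset.mem_range.1 hj)
    have h2 := hS h1
    simp only [Set.mem_iUnion, Metric.mem_ball, dist_eq_norm] at h2
    obtain ⟨s, hs, h⟩ := h2
    exact ⟨s, hs, h.le⟩
  choose! c hcS hc using hmem
  have hS0 : S.Nonempty := ⟨c 0, hcS 0 (Finset.mem_range.2 (by positivity))⟩
  obtain ⟨s, -, hs⟩ := Finset.exists_le_card_fiber_of_mul_le_card_of_maps_to
    (s := Finset.range ((S.card + 1) * m)) (n := m) hcS hS0
    (by rw [Finset.card_range]; exact Nat.mul_le_mul_right _ (by omega))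
  obtain ⟨J, hJ, hJm⟩ := Finset.exists_subset_card_eq hs
  obtain ⟨j₀, hj₀⟩ : J.Nonempty := by
    rw [← Finset.card_pos]
    omega
  have hJ1 : ∀ j ∈ J, j ∈ Finset.range ((S.card + 1) * m) ∧ c j = s := fun j hj =>
    Finset.mem_filter.1 (hJ hj)
  refine ⟨j₀, Finset.mem_range.1 (hJ1 j₀ hj₀).1, J, fun j hj => (hJ1 j hj).1, hJm,
    fun j hj => ?_⟩
  have e1 := hc j (hJ1 j hj).1
  have e2 := hc j₀ (hJ1 j₀ hj₀).1
  rw [(hJ1 j hj).2] at e1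
  rw [(hJ1 j₀ hj₀).2] at e2
  have e3 : ζ j - ζ j₀ = t • ((t⁻¹ • ζ j - s) - (t⁻¹ • ζ j₀ - s)) := by
    rw [sub_sub_sub_cancel_right, ← smul_sub, smul_smul, mul_inv_cancel₀ ht.ne', one_smul]
  rw [e3, norm_smul, Real.norm_of_nonneg ht.le]
  have e4 := norm_sub_le (t⁻¹ • ζ j - s) (t⁻¹ • ζ j₀ - s)
  nlinarith

/-- The increments of `F` on a ball of radius `t` around any point recur, up to an error `A`, at
distance at most `B * t` from any other point. -/
def IncrementsRecur (F : E → ℝ) (A B t : ℝ) : Prop :=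
  ∀ y c : E, ∃ z : E, ‖z - c‖ ≤ B * t ∧
    ∀ u : E, ‖u‖ ≤ t → |(F (z + u) - F z) - (F (y + u) - F y)| ≤ A

/-- The contraction step. If the increments along some long vector `v = N • w` at `p` and `q`
differed by almost the trivial bound, then every piece along `w` would be nearly maximal on the
line through `p` and nearly minimal on the line through `q`. Copies of a minimal piece recur near
each piece of the first line; by the pigeonhole principle several of them lie, up to a shift of
length `t`, on one common parallel line. That line loses more than moving over to it from the
first line can account for. -/
lemma scaleOscBound_contract (B κ : ℕ)
    (hκ : ∀ (m : ℕ) (t : ℝ) (ζ : ℕ → E), 0 < m → 0 < t →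
      (∀ j < κ * m, ‖ζ j‖ ≤ ((4 * B : ℕ) : ℝ) * t) →
      ∃ j₀ < κ * m, ∃ J ⊆ Finset.range (κ * m), J.card = m ∧ ∀ j ∈ J, ‖ζ j - ζ j₀‖ ≤ t)
    (hκ0 : 0 < κ) {A t Ω : ℝ} (ht : 0 < t)
    (hrec : IncrementsRecur F A B (4 * t)) (hΩ : ScaleOscBound F t Ω) :
    ScaleOscBound F (((4 * (κ * (2 * B + 1)) : ℕ) : ℝ) * t)
      ((((4 * (κ * (2 * B + 1)) : ℕ) : ℝ) - 1) * Ω + ((2 * B + 1 : ℕ) : ℝ) * A) := by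
  classical
  set m : ℕ := 2 * B + 1 with hm
  have hm0 : 0 < m := by omega
  set N : ℕ := κ * m with hN
  have hN0 : 0 < N := by positivity
  have hN' : (0 : ℝ) < N := by exact_mod_cast hN0
  intro v hv p q
  by_contra! hcon
  have hΩ0 : 0 ≤ Ω := (hΩ 0 (by simpa using ht.le)).nonneg
  set w : E := (N : ℝ)⁻¹ • v with hw
  have hNw : N • w = v := by
    rw [← Nat.cast_smul_eq_nsmul ℝ, hw, smul_smul, mul_inv_cancel₀ hN'.ne', one_smul]
  have hwt : ‖w‖ ≤ 4 * t := by
    rw [hw, norm_smul, norm_inv, Real.norm_natCast, inv_mul_le_iff₀ hN']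
    push_cast at hv ⊢
    linarith
  set d : E → ℝ := fun y => F (y + w) - F y with hd
  have hdd : ∀ y y', d y - d y' ≤ 4 * Ω := by
    have h4 := hΩ.nsmul 4
    push_cast at h4
    exact h4 w hwt
  have hsum : ∀ y, ∑ j ∈ Finset.range N, d (y + j • w) = F (y + v) - F y := by
    intro y
    rw [← hNw]
    exact sum_increments F y w N
  obtain ⟨i, hi, hmin⟩ := Finset.exists_min_image (Finset.range N) (fun j => d (q + j • w))
    ⟨0, Finset.mem_range.2 hN0⟩
  choose z hz hzd using fun j : ℕ => hrec (q + i • w) (p + j • w)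
  obtain ⟨j₀, hj₀, J, hJ, hJm, hJt⟩ := hκ m t (fun j => z j - (p + j • w)) hm0 ht (by
    intro j _
    refine (hz j).trans_eq ?_
    push_cast
    ring)
  set ζ : E := z j₀ - (p + j₀ • w) with hζ
  -- the parallel line through `p + ζ`, compared with the line through `p`
  have hpar : F (p + v) - F p - (F (p + ζ + v) - F (p + ζ)) ≤ ((4 * B : ℕ) : ℝ) * Ω := by
    have h1 : OscBound F ζ (((4 * B : ℕ) : ℝ) * Ω) := by
      refine hΩ.nsmul (4 * B) ζ ((hz j₀).trans_eq ?_)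
      push_cast
      ring
    have h2 := h1 p (p + v)
    rw [add_right_comm p ζ v]
    linarith
  have hJd : ∀ j ∈ J, d (p + ζ + j • w) - d (q + j • w) ≤ A + Ω := by
    intro j hj
    have h1 : OscBound F (ζ - (z j - (p + j • w))) Ω := by
      refine hΩ _ ?_
      rw [norm_sub_rev]
      exact hJt j hj
    have h2 := h1 (z j + w) (z j)
    have e1 : z j + (ζ - (z j - (p + j • w))) = p + ζ + j • w := by abel
    have e2 : z j + w + (ζ - (z j - (p + j • w))) = p + ζ + j • w + w := by abel
    rw [e1, e2] at h2
    have h3 := (abs_le.1 (hzd j w hwt)).2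
    have h4 := hmin j (hJ hj)
    simp only [hd] at h4 ⊢
    linarith
  have hle : ∑ j ∈ Finset.range N, (d (p + ζ + j • w) - d (q + j • w))
      ≤ ∑ j ∈ Finset.range N, (4 * Ω + if j ∈ J then A - 3 * Ω else 0) := by
    refine Finset.sum_le_sum fun j _ => ?_
    split_ifs with h
    · linarith [hJd j h]
    · linarith [hdd (p + ζ + j • w) (q + j • w)]
  rw [Finset.sum_sub_distrib, hsum, hsum, Finset.sum_add_distrib, Finset.sum_ite_mem,
    Finset.inter_eq_right.2 hJ, Finset.sum_const, Finset.sum_const, Finset.card_range, hJm,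
    nsmul_eq_mul, nsmul_eq_mul] at hle
  push_cast at hle hpar hcon
  have hmB : (m : ℝ) = 2 * B + 1 := by
    rw [hm]
    push_cast
    ring
  rw [hmB] at hle hcon
  have hBΩ : 0 ≤ (B : ℝ) * Ω := by positivity
  nlinarith

/-- Iterating the contraction step gives a power saving, with an exponent that depends only on `B`
and on the dimension. -/
lemma exists_exponent_of_increments_recur [FiniteDimensional ℝ E] (B : ℕ) :
    ∃ γ : ℝ, 0 < γ ∧ γ < 1 ∧ ∀ (F : E → ℝ) (A t₀ : ℝ), 0 < t₀ →
      (∀ p q, |F p - F q| ≤ A * (‖p - q‖ + 1)) →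
      (∀ t, t₀ ≤ t → IncrementsRecur F A B t) →
      ∃ C : ℝ, 0 ≤ C ∧ ∀ v, OscBound F v (C * (1 + ‖v‖ ^ γ)) := by
  obtain ⟨κ, hκ0, hκ⟩ := exists_cluster (E := E) ((4 * B : ℕ) : ℝ)
  set N : ℕ := 4 * (κ * (2 * B + 1)) with hN
  have hN4 : 4 ≤ N := by
    have : 0 < κ * (2 * B + 1) := by positivity
    omega
  have hN4' : (4 : ℝ) ≤ N := by exact_mod_cast hN4
  set l : ℝ := (N : ℝ) - 1 with hl
  have hlogN : 0 < Real.log N := Real.log_pos (by linarith)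
  have hlogl : 0 < Real.log l := Real.log_pos (by linarith)
  set γ : ℝ := Real.log l / Real.log N with hγ
  have hγ0 : 0 < γ := by positivity
  have hNγ : (N : ℝ) ^ γ = l := by
    rw [Real.rpow_def_of_pos (by linarith), hγ, mul_div_cancel₀ _ hlogN.ne',
      Real.exp_log (by linarith)]
  refine ⟨γ, hγ0, ?_, fun F A t₀ ht₀ hF hrec => ?_⟩
  · rw [hγ, div_lt_one hlogN]
    exact Real.log_lt_log (by linarith) (by linarith)
  have hA : 0 ≤ A := by simpa using hF 0 0
  set A' : ℝ := ((2 * B + 1 : ℕ) : ℝ) * A with hA'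
  have hA'0 : 0 ≤ A' := by positivity
  set C₀ : ℝ := 2 * (A * (t₀ + 1)) + A' with hC₀
  have hC₀0 : 0 ≤ C₀ := by positivity
  have hiter : ∀ j : ℕ, ScaleOscBound F ((N : ℝ) ^ j * t₀) (C₀ * l ^ j - A') := by
    intro j
    induction j with
    | zero =>
      intro v hv p q
      simp only [pow_zero, one_mul, mul_one] at hv ⊢
      have h1 := abs_le.1 (hF (p + v) p)
      have h2 := abs_le.1 (hF (q + v) q)
      rw [add_sub_cancel_left] at h1 h2
      have h3 : A * (‖v‖ + 1) ≤ A * (t₀ + 1) := by gcongr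
      rw [hC₀]
      linarith [h1.2, h2.1]
    | succ j ih =>
      have h1 : 1 ≤ (N : ℝ) ^ j := one_le_pow₀ (by linarith)
      have h2 := scaleOscBound_contract B κ hκ hκ0 (by positivity)
        (hrec (4 * ((N : ℝ) ^ j * t₀)) (by nlinarith)) ih
      rw [← hN, ← hl, ← hA'] at h2
      intro v hv
      refine (h2 v ?_).mono ?_
      · refine hv.trans_eq ?_
        rw [pow_succ]
        ring
      · rw [pow_succ]
        nlinarith
  set C : ℝ := C₀ * (1 + (N / t₀) ^ γ) with hC
  have hNt : 0 ≤ (N / t₀ : ℝ) ^ γ := by positivity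
  refine ⟨C, by positivity, fun v => ?_⟩
  have hvγ : 0 ≤ ‖v‖ ^ γ := by positivity
  rcases le_or_gt ‖v‖ t₀ with hvt | hvt
  · refine (hiter 0 v (by simpa using hvt)).mono ?_
    have h1 : 1 ≤ (1 + (N / t₀ : ℝ) ^ γ) * (1 + ‖v‖ ^ γ) := by nlinarith
    rw [pow_zero, mul_one, hC, mul_assoc]
    nlinarith
  · -- the scale `N ^ j * t₀` just above `‖v‖`
    obtain ⟨j, hj1, hj2⟩ := exists_nat_pow_near (x := ‖v‖ / t₀) (y := (N : ℝ))
      (by rw [le_div_iff₀ ht₀]; linarith) (by linarith)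
    rw [le_div_iff₀ ht₀] at hj1
    rw [div_lt_iff₀ ht₀] at hj2
    refine (hiter (j + 1) v hj2.le).mono ?_
    have h1 : l ^ (j + 1) ≤ (N / t₀) ^ γ * ‖v‖ ^ γ := by
      rw [← hNγ, Real.rpow_pow_comm (by linarith), ← Real.mul_rpow (by positivity) (norm_nonneg v)]
      refine Real.rpow_le_rpow (by positivity) ?_ hγ0.le
      rw [pow_succ, div_mul_eq_mul_div, le_div_iff₀ ht₀]
      nlinarith
    have h2 : (N / t₀ : ℝ) ^ γ * ‖v‖ ^ γ ≤ (1 + (N / t₀) ^ γ) * (1 + ‖v‖ ^ γ) := by nlinarith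
    have h3 : C₀ * l ^ (j + 1) ≤ C₀ * ((1 + (N / t₀) ^ γ) * (1 + ‖v‖ ^ γ)) := by
      gcongr
      exact h1.trans h2
    rw [hC, mul_assoc]
    linarith

end Contraction

/-! ### Patches and the large-scale extension of an additive function -/

section Patches

variable {E : Type*} [NormedAddCommGroup E]

lemma IsFiniteType.exists_covering {X : Set E} (hX : IsFiniteType X) :
    ∃ R : ℝ, 0 < R ∧ ∀ p : E, ∃ x ∈ X, ‖x - p‖ ≤ R := by
  obtain ⟨⟨D, rfl⟩, -⟩ := hX
  refine ⟨D.coveringRadius, D.coveringRadius_pos, fun p => ?_⟩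
  obtain ⟨x, hx, h⟩ := D.isCover_coveringRadius (Set.mem_univ p)
  refine ⟨x, hx, ?_⟩
  have h1 : edist p x ≤ (D.coveringRadius : ENNReal) := h
  rw [edist_nndist, ENNReal.coe_le_coe] at h1
  rw [← dist_eq_norm, dist_comm]
  exact_mod_cast h1

lemma IsFiniteType.finite_differences {X : Set E} (hX : IsFiniteType X) (ρ : ℝ) :
    ((X - X) ∩ Metric.closedBall 0 ρ).Finite :=
  hX.2 _ Metric.isBounded_closedBall

/-- A Delone set of finite type has finitely many patches of each radius, so that its
patch-counting function has no junk value. -/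
lemma IsFiniteType.finite_atlas {X : Set E} (hX : IsFiniteType X) (T : ℝ) :
    (atlas X T).Finite := by
  refine (hX.finite_differences T).finite_subsets.subset ?_
  rintro _ ⟨x, hx, rfl⟩ _ ⟨y, ⟨hy, hyT⟩, rfl⟩
  refine ⟨Set.sub_mem_sub hy hx, ?_⟩
  rwa [mem_closedBall_zero_iff, ← dist_eq_norm]

lemma isRepetitivityRadius_add_one {X : Set E} (hX : IsRepetitive X) {T : ℝ} (hT : 0 < T) :
    IsRepetitivityRadius X T (repetitivity X T + 1) := by
  obtain ⟨M, hM⟩ := hX T hT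
  obtain ⟨M', hM', hlt⟩ := exists_lt_of_csInf_lt (s := {M | 0 < M ∧ IsRepetitivityRadius X T M})
    ⟨M, hM⟩ (show sInf _ < repetitivity X T + 1 from lt_add_one _)
  intro c P hP
  obtain ⟨y, ⟨hy, hyc⟩, h⟩ := hM'.2 c P hP
  exact ⟨y, ⟨hy, Metric.closedBall_subset_closedBall hlt.le hyc⟩, h⟩

lemma repetitivity_nonneg (X : Set E) (T : ℝ) : 0 ≤ repetitivity X T :=
  Real.sInf_nonneg fun _ h => h.1.le

section Extension

variable {X : Set E} {f : E → ℝ}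

lemma exists_bound_of_finite_differences {ρ : ℝ}
    (hfin : ((X - X) ∩ Metric.closedBall 0 ρ).Finite)
    (hf : ∀ a ∈ X, ∀ b ∈ X, f (a - b) = f a - f b) :
    ∃ A : ℝ, 0 ≤ A ∧ ∀ a ∈ X, ∀ b ∈ X, ‖a - b‖ ≤ ρ → |f a - f b| ≤ A := by
  obtain ⟨A, hA⟩ := (hfin.image fun x => |f x|).bddAbove
  refine ⟨max A 0, le_max_right _ _, fun a ha b hb hab => le_max_of_le_left ?_⟩
  rw [← hf a ha b hb]
  exact hA ⟨a - b, ⟨Set.sub_mem_sub ha hb, by simpa using hab⟩, rfl⟩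

lemma coarse_lipschitz_of_unit_steps [NormedSpace ℝ E] {F : E → ℝ} {A : ℝ}
    (hF : ∀ p q, ‖p - q‖ ≤ 1 → |F p - F q| ≤ A) (p q : E) :
    |F p - F q| ≤ A * (‖p - q‖ + 1) := by
  have hA : 0 ≤ A := (abs_nonneg _).trans (hF 0 0 (by simp))
  set N := ⌈‖p - q‖⌉₊ with hN
  rcases Nat.eq_zero_or_pos N with h0 | hpos
  · have h1 : p = q := by
      rw [hN, Nat.ceil_eq_zero] at h0
      exact sub_eq_zero.1 (norm_le_zero_iff.1 h0)
    subst h1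
    simpa using hA
  · have hN' : (0 : ℝ) < N := by exact_mod_cast hpos
    set w : E := (N : ℝ)⁻¹ • (p - q) with hw
    have hNw : q + N • w = p := by
      rw [← Nat.cast_smul_eq_nsmul ℝ, hw, smul_smul, mul_inv_cancel₀ hN'.ne', one_smul,
        add_sub_cancel]
    have hw1 : ‖w‖ ≤ 1 := by
      rw [hw, norm_smul, norm_inv, Real.norm_natCast, inv_mul_le_iff₀ hN', mul_one]
      exact Nat.le_ceil _
    have h1 := sum_increments F q w N
    rw [hNw] at h1
    rw [← h1]
    refine (Finset.abs_sum_le_sum_abs _ _).trans ?_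
    refine (Finset.sum_le_sum fun j _ => hF _ _ (by rwa [add_sub_cancel_left])).trans ?_
    rw [Finset.sum_const, Finset.card_range, nsmul_eq_mul, mul_comm]
    have := (Nat.ceil_lt_add_one (norm_nonneg (p - q))).le
    gcongr

/-- `F` is a large-scale extension of the additive function `f` from `X` to the whole space, with
error `A`: its increments around a point of `X` are determined, up to `A`, by the patch of `X`
around this point. -/
structure IsCoarseExtension (X : Set E) (f F : E → ℝ) (R A : ℝ) : Prop where
  nonneg : 0 ≤ A
  lipschitz : ∀ p q, |F p - F q| ≤ A * (‖p - q‖ + 1)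
  near : ∀ x ∈ X, |F x - f x| ≤ A
  patch : ∀ x ∈ X, ∀ x' ∈ X, ∀ T, centredPatch X x T = centredPatch X x' T →
    ∀ u, ‖u‖ + R ≤ T → |(F (x + u) - F x) - (F (x' + u) - F x')| ≤ A

/-- The extension evaluates `f` at some point of `X` at distance at most `R`. -/
lemma exists_isCoarseExtension [NormedSpace ℝ E] {R : ℝ} (hR : ∀ p : E, ∃ x ∈ X, ‖x - p‖ ≤ R)
    (hX : IsFiniteType X) (hf : ∀ a ∈ X, ∀ b ∈ X, f (a - b) = f a - f b) :
    ∃ (F : E → ℝ) (A : ℝ), IsCoarseExtension X f F R A := by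
  choose ξ hξX hξ using hR
  have hR0 : 0 ≤ R := (norm_nonneg _).trans (hξ 0)
  obtain ⟨A, hA, hfA⟩ := exists_bound_of_finite_differences
    (hX.finite_differences (2 * R + 1)) hf
  have hnear : ∀ x ∈ X, ∀ p, ‖x - p‖ ≤ R → |f (ξ p) - f x| ≤ A := by
    intro x hx p hp
    refine hfA _ (hξX p) _ hx ?_
    have h1 := norm_sub_le (ξ p - p) (x - p)
    rw [sub_sub_sub_cancel_right] at h1
    linarith [hξ p]
  have hnear' : ∀ x ∈ X, |f (ξ x) - f x| ≤ A := fun x hx => hnear x hx x (by simpa using hR0)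
  refine ⟨fun p => f (ξ p), 3 * A, by positivity, ?_, ?_, ?_⟩
  · refine coarse_lipschitz_of_unit_steps fun p q hpq => ?_
    have h1 : |f (ξ p) - f (ξ q)| ≤ A := by
      refine hfA _ (hξX p) _ (hξX q) ?_
      have e : ξ p - ξ q = (ξ p - p) - (ξ q - q) + (p - q) := by abel
      rw [e]
      have h2 := norm_add_le ((ξ p - p) - (ξ q - q)) (p - q)
      have h3 := norm_sub_le (ξ p - p) (ξ q - q)
      linarith [hξ p, hξ q]
    linarith
  · intro x hx
    linarith [hnear' x hx]
  · intro x hx x' hx' T hT u hu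
    have h1 : ξ (x + u) - x ∈ centredPatch X x T := by
      refine ⟨_, ⟨hξX _, ?_⟩, rfl⟩
      rw [Metric.mem_closedBall, dist_eq_norm]
      have e : ξ (x + u) - x = (ξ (x + u) - (x + u)) + u := by abel
      rw [e]
      linarith [norm_add_le (ξ (x + u) - (x + u)) u, hξ (x + u)]
    rw [hT] at h1
    obtain ⟨a', ⟨ha', -⟩, h2⟩ := h1
    have h2' : a' - x' = ξ (x + u) - x := h2
    have h3 : f (ξ (x + u)) - f x = f a' - f x' := by
      rw [← hf _ (hξX _) _ hx, ← hf _ ha' _ hx', h2']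
    have h4 : |f (ξ (x' + u)) - f a'| ≤ A := by
      refine hnear a' ha' _ ?_
      have e : a' - (x' + u) = ξ (x + u) - (x + u) := by
        rw [← sub_sub, h2', sub_sub]
      rw [e]
      exact hξ _
    have h5 := abs_le.1 (hnear' x hx)
    have h6 := abs_le.1 (hnear' x' hx')
    have h7 := abs_le.1 h4
    rw [abs_le]
    constructor <;> linarith [h5.1, h5.2, h6.1, h6.2, h7.1, h7.2]

end Extension

/-- Linear repetitivity in terms of increments. The constants `B` and `t₀` depend only on `X`. -/
lemma IsLinearlyRepetitive.increments_recur {X : Set E} (hX : IsLinearlyRepetitive X) {R : ℝ}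
    (hR0 : 0 < R) (hR : ∀ p : E, ∃ x ∈ X, ‖x - p‖ ≤ R) :
    ∃ (B : ℕ) (t₀ : ℝ), 0 < t₀ ∧ ∀ (f F : E → ℝ) (A : ℝ), IsCoarseExtension X f F R A →
      ∀ t, t₀ ≤ t → IncrementsRecur F (2 * A) B t := by
  obtain ⟨-, hrep, hO⟩ := hX
  obtain ⟨c, hc0, hc⟩ := hO.exists_nonneg
  obtain ⟨T₀, hT₀⟩ := eventually_atTop.1 hc.bound
  obtain ⟨B, hB⟩ := exists_nat_ge (c * (1 + 2 * R) + 1 + R)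
  refine ⟨B, max T₀ 1, by positivity, fun f F A hF t ht y p => ?_⟩
  have ht1 : 1 ≤ t := (le_max_right _ _).trans ht
  have htT : T₀ ≤ t := (le_max_left _ _).trans ht
  obtain ⟨x, hx, hxy⟩ := hR y
  obtain ⟨x', ⟨hx', hxc⟩, hpatch⟩ := isRepetitivityRadius_add_one hrep
    (T := t + 2 * R) (by positivity) p _ ⟨x, hx, rfl⟩
  set e : E := y - x with he
  have hee : ‖e‖ ≤ R := by
    rw [he, norm_sub_rev]
    exact hxy
  have hM := hT₀ (t + 2 * R) (by linarith)
  rw [Real.norm_of_nonneg (repetitivity_nonneg _ _),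
    Real.norm_of_nonneg (by positivity)] at hM
  refine ⟨x' + e, ?_, fun u hu => ?_⟩
  · rw [Metric.mem_closedBall, dist_eq_norm] at hxc
    have h1 : x' + e - p = (x' - p) + e := by abel
    rw [h1]
    have h2 := norm_add_le (x' - p) e
    have h3 : (c * (1 + 2 * R) + 1 + R) * t ≤ B * t := by gcongr
    have h4 : c * (2 * R) * 1 ≤ c * (2 * R) * t := by gcongr
    nlinarith
  · have hye : y = x + e := by simp [he]
    have h1 := abs_le.1 (hF.patch x hx x' hx' _ hpatch.symm e (by linarith))
    have h2 := abs_le.1 (hF.patch x hx x' hx' _ hpatch.symm (e + u) (by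
      linarith [norm_add_le e u]))
    rw [hye, add_assoc x', add_assoc x, abs_le]
    constructor <;> linarith [h1.1, h1.2, h2.1, h2.2]

end Patches

/-! ### Asymptotic slopes and dense repetitivity -/

section Growth

variable {E : Type*} [NormedAddCommGroup E] {F : E → ℝ} {A : ℝ}

lemma nsmul_norm_le (k : ℕ) (e : E) : ‖k • e‖ ≤ k * ‖e‖ := by
  induction k with
  | zero => simp
  | succ k ih =>
    rw [succ_nsmul]
    push_cast
    linarith [norm_add_le (k • e) e]

/-- The maximal asymptotic slope `σ` of `F` in the direction `e`, obtained from Fekete's lemma: long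
increments have slope at most `σ + ε`, and increments of every length reach slope `σ`. -/
lemma exists_asymptotic_slope (hF : ∀ p q, |F p - F q| ≤ A * (‖p - q‖ + 1)) (e : E) :
    ∃ σ : ℝ, (∀ ε > 0, ∀ᶠ U : ℕ in atTop, ∀ p, F (p + U • e) - F p ≤ U * (σ + ε)) ∧
      ∀ W : ℕ, ∃ p, W * σ - 1 ≤ F (p + W • e) - F p := by
  have hA : 0 ≤ A := by simpa using hF 0 0
  have hinc : ∀ (k : ℕ) p, |F (p + k • e) - F p| ≤ A * (k * ‖e‖ + 1) := by
    intro k p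
    refine (hF _ _).trans ?_
    rw [add_sub_cancel_left]
    have := nsmul_norm_le k e
    gcongr
  set s : ℕ → ℝ := fun k => ⨆ p, (F (p + k • e) - F p) with hs
  have hbdd : ∀ k : ℕ, BddAbove (Set.range fun p => F (p + k • e) - F p) := by
    intro k
    refine ⟨A * (k * ‖e‖ + 1), ?_⟩
    rintro _ ⟨p, rfl⟩
    exact (le_abs_self _).trans (hinc k p)
  have hle : ∀ (k : ℕ) p, F (p + k • e) - F p ≤ s k := fun k p => le_ciSup (hbdd k) p
  have hsub : Subadditive s := by
    intro k l
    refine ciSup_le fun p => ?_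
    have h1 := hle k p
    have h2 := hle l (p + k • e)
    rw [add_nsmul, ← add_assoc]
    linarith
  have hbelow : BddBelow (Set.range fun k : ℕ => s k / k) := by
    refine ⟨-(A * (‖e‖ + 1)), ?_⟩
    rintro _ ⟨k, rfl⟩
    rcases Nat.eq_zero_or_pos k with rfl | hk
    · simp only [Nat.cast_zero, div_zero, Left.neg_nonpos_iff]
      positivity
    · have hk' : (1 : ℝ) ≤ k := by exact_mod_cast hk
      change _ ≤ s k / k
      rw [le_div_iff₀ (by linarith)]
      have h1 := hle k 0
      have h2 := (abs_le.1 (hinc k 0)).1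
      nlinarith [mul_nonneg hA (sub_nonneg.2 hk')]
  refine ⟨hsub.lim, fun ε hε => ?_, fun W => ?_⟩
  · filter_upwards [(hsub.tendsto_lim hbelow).eventually_lt_const (lt_add_of_pos_right _ hε),
      eventually_gt_atTop 0] with U hU hU0 p
    have hU0' : (0 : ℝ) < U := by exact_mod_cast hU0
    rw [div_lt_iff₀ hU0'] at hU
    linarith [hle U p]
  · have h1 : W * hsub.lim ≤ s W := by
      rcases Nat.eq_zero_or_pos W with rfl | hW
      · simpa using hle 0 0
      · have hW' : (0 : ℝ) < W := by exact_mod_cast hW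
        have := hsub.lim_le_div hbelow hW.ne'
        rw [le_div_iff₀ hW'] at this
        linarith
    obtain ⟨p, hp⟩ := exists_lt_of_lt_ciSup (show W * hsub.lim - 1 < s W by linarith)
    exact ⟨p, hp.le⟩

lemma sum_range_shift_sub (h : ℕ → ℝ) (U W : ℕ) :
    ∑ a ∈ Finset.range W, (h (a + U) - h a) = ∑ r ∈ Finset.range U, (h (W + r) - h r) := by
  have h1 := Finset.sum_range_add h U W
  have h2 := Finset.sum_range_add h W U
  rw [add_comm W U] at h2
  rw [Finset.sum_sub_distrib, Finset.sum_sub_distrib]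
  simp only [add_comm _ U]
  linarith

/-- If every translate of a finite set `Q` contains at least the proportion `1 / D` of points at
which the slope of `F` over the length `U` is smaller by `g` than its upper bound `σ + ε`, then the
average slope along a tube of lines parallel to `e` is at most `σ + ε - g / D`. As `σ` is reached
along arbitrarily long lines, this forces `g ≤ D * ε`. -/
lemma slope_gap_le (hF : ∀ p q, |F p - F q| ≤ A * (‖p - q‖ + 1)) {e : E} {U : ℕ} (hU : 0 < U)
    {σ ε g D : ℝ} (hg : 0 ≤ g) (hD : 0 ≤ D) {Q : Finset E} (hQ : Q.Nonempty)
    (hup : ∀ p, F (p + U • e) - F p ≤ U * (σ + ε))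
    (hlong : ∀ W : ℕ, ∃ p, W * σ - 1 ≤ F (p + W • e) - F p)
    (hlow : ∀ y, (Q.card : ℝ) ≤
      D * (Q.filter fun κ => F (y + κ + U • e) - F (y + κ) ≤ U * (σ + ε - g)).card) :
    g ≤ D * ε := by
  classical
  have hA : 0 ≤ A := by simpa using hF 0 0
  have hU' : (0 : ℝ) < U := by exact_mod_cast hU
  have hq : (0 : ℝ) < Q.card := by exact_mod_cast hQ.card_pos
  set K : ℝ := 1 + 2 * (A * ((∑ κ ∈ Q, ‖κ‖ + U * ‖e‖) + 1)) with hK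
  have key : ∀ W : ℕ, (g - D * ε) * W ≤ D * K := by
    intro W
    obtain ⟨p, hp⟩ := hlong W
    set G : E → ℝ := fun y => F (y + U • e) - F y - U * (σ + ε) with hG
    have hline : ∀ κ ∈ Q, U * (-K - W * ε) ≤ ∑ a ∈ Finset.range W, G (p + κ + a • e) := by
      intro κ hκ
      have h1 : ∑ a ∈ Finset.range W, G (p + κ + a • e)
          = ∑ r ∈ Finset.range U, ((F (p + κ + (W + r) • e) - F (p + κ + r • e))
              - W * (σ + ε)) := by
        have h2 := sum_range_shift_sub (fun a => F (p + κ + a • e)) U W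
        simp only [hG]
        rw [Finset.sum_sub_distrib (s := Finset.range W), Finset.sum_sub_distrib (s := Finset.range U),
          ← h2]
        simp only [add_nsmul, add_assoc, Finset.sum_const, Finset.card_range, nsmul_eq_mul]
        ring
      rw [h1]
      have h3 : U * (-K - W * ε) = ∑ r ∈ Finset.range U, (-K - W * ε) := by
        rw [Finset.sum_const, Finset.card_range, nsmul_eq_mul]
      rw [h3]
      refine Finset.sum_le_sum fun r hr => ?_
      have hn : ‖κ + r • e‖ ≤ ∑ κ ∈ Q, ‖κ‖ + U * ‖e‖ := by
        refine (norm_add_le _ _).trans (add_le_add ?_ ((nsmul_norm_le r e).trans ?_))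
        · exact Finset.single_le_sum (f := fun κ : E => ‖κ‖) (fun _ _ => norm_nonneg _) hκ
        · have : (r : ℝ) ≤ U := by exact_mod_cast (Finset.mem_range.1 hr).le
          gcongr
      have h4 : A * (‖κ + r • e‖ + 1) ≤ A * ((∑ κ ∈ Q, ‖κ‖ + U * ‖e‖) + 1) := by gcongr
      have h5 := abs_le.1 (hF (p + κ + (W + r) • e) (p + W • e))
      have h6 := abs_le.1 (hF (p + κ + r • e) p)
      have e1 : p + κ + (W + r) • e - (p + W • e) = κ + r • e := by
        rw [add_nsmul]
        abel
      have e2 : p + κ + r • e - p = κ + r • e := by abel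
      rw [e1] at h5
      rw [e2] at h6
      rw [hK]
      linarith [h5.1, h6.2]
    have hcube : ∀ a : ℕ, D * ∑ κ ∈ Q, G (p + κ + a • e) ≤ -(U * g * Q.card) := by
      intro a
      have h1 := hlow (p + a • e)
      set S := Q.filter fun κ =>
        F (p + a • e + κ + U • e) - F (p + a • e + κ) ≤ U * (σ + ε - g) with hS
      have h2 : ∑ κ ∈ Q, G (p + κ + a • e) ≤ ∑ κ ∈ Q, if κ ∈ S then -(U * g) else 0 := by
        refine Finset.sum_le_sum fun κ _ => ?_
        rw [add_right_comm p κ]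
        split_ifs with h
        · have := (Finset.mem_filter.1 h).2
          simp only [hG]
          linarith
        · simp only [hG]
          linarith [hup (p + a • e + κ)]
      rw [Finset.sum_ite_mem, Finset.inter_eq_right.2 (Finset.filter_subset _ _),
        Finset.sum_const, nsmul_eq_mul] at h2
      have h3 := mul_le_mul_of_nonneg_left h2 hD
      have h4 := mul_le_mul_of_nonneg_left h1 (mul_nonneg hU'.le hg)
      linarith
    have h1 : D * (Q.card * (U * (-K - W * ε)))
        ≤ D * ∑ κ ∈ Q, ∑ a ∈ Finset.range W, G (p + κ + a • e) := by
      refine mul_le_mul_of_nonneg_left ?_ hD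
      rw [← nsmul_eq_mul]
      exact Finset.card_nsmul_le_sum _ _ _ hline
    have h2 : D * ∑ κ ∈ Q, ∑ a ∈ Finset.range W, G (p + κ + a • e)
        ≤ W * (-(U * g * Q.card)) := by
      rw [Finset.sum_comm, Finset.mul_sum]
      refine (Finset.sum_le_sum fun a _ => hcube a).trans ?_
      rw [Finset.sum_const, Finset.card_range, nsmul_eq_mul]
    have h3 : (U * Q.card : ℝ) * ((g - D * ε) * W) ≤ (U * Q.card) * (D * K) := by linarith
    exact le_of_mul_le_mul_left h3 (by positivity)
  by_contra! hlt
  obtain ⟨W, hW⟩ := exists_nat_gt (D * K / (g - D * ε))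
  rw [div_lt_iff₀ (by linarith)] at hW
  linarith [key W]

end Growth

section Grid

variable {n : ℕ}

lemma norm_le_sum_abs (x : EuclideanSpace ℝ (Fin n)) : ‖x‖ ≤ ∑ i, |x i| := by
  conv_lhs => rw [← (EuclideanSpace.basisFun (Fin n) ℝ).sum_repr x]
  refine (norm_sum_le _ _).trans (Finset.sum_le_sum fun i _ => ?_)
  rw [norm_smul]
  simp

/-- The integer points of the cube `[-m, m]ⁿ`. -/
noncomputable def gridCube (n m : ℕ) : Finset (EuclideanSpace ℝ (Fin n)) :=
  open scoped Classical in
  (Fintype.piFinset fun _ : Fin n => Finset.Icc (-(m : ℤ)) m).image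
    fun k => WithLp.toLp 2 fun i => (k i : ℝ)

lemma gridCube_nonempty (n m : ℕ) : (gridCube n m).Nonempty := by
  classical
  exact (Fintype.piFinset_nonempty.2 fun _ => ⟨0, by simp⟩).image _

lemma card_gridCube_le (n m : ℕ) : (gridCube n m).card ≤ (2 * m + 1) ^ n := by
  classical
  refine Finset.card_image_le.trans ?_
  rw [Fintype.card_piFinset]
  simp only [Int.card_Icc, Finset.prod_const, Finset.card_univ, Fintype.card_fin]
  apply le_of_eq
  congr 1
  omega

lemma exists_mem_gridCube_near {m : ℕ} (x : EuclideanSpace ℝ (Fin n)) (hx : ‖x‖ ≤ m) :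
    ∃ κ ∈ gridCube n m, ‖x - κ‖ ≤ n := by
  classical
  refine ⟨WithLp.toLp 2 fun i => (round (x i) : ℝ), ?_, ?_⟩
  · refine Finset.mem_image.2 ⟨fun i => round (x i), Fintype.mem_piFinset.2 fun i => ?_, rfl⟩
    have h1 := abs_le.1 (((PiLp.norm_apply_le x i).trans hx))
    have h2 := abs_le.1 (abs_sub_round (x i))
    rw [Finset.mem_Icc]
    constructor
    · have : ((-(m : ℤ) - 1 : ℤ) : ℝ) < (round (x i) : ℝ) := by
        push_cast
        linarith [h1.1, h2.2]
      have := Int.cast_lt.1 this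
      omega
    · have : (round (x i) : ℝ) < (((m : ℤ) + 1 : ℤ) : ℝ) := by
        push_cast
        linarith [h1.2, h2.1]
      have := Int.cast_lt.1 this
      omega
  · refine (norm_le_sum_abs _).trans ?_
    have : ∑ i : Fin n, (1 : ℝ) = n := by simp
    rw [← this]
    refine Finset.sum_le_sum fun i _ => ?_
    have h2 := abs_sub_round (x i)
    simp only [PiLp.sub_apply]
    linarith

/-- If a property holds near all occurrences of the patches in `𝒬`, and each of these patches
occurs in every ball of radius `m`, then the grid points with this property in any translate of the
cube number at least a fixed multiple of the number of patches. -/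
lemma card_patches_le {X : Set (EuclideanSpace ℝ (Fin n))} {C₀ : ℕ}
    (hfin : ((X - X) ∩ Metric.closedBall 0 (2 * n)).Finite)
    (hC₀ : ((X - X) ∩ Metric.closedBall 0 (2 * n)).ncard ≤ C₀)
    {T : ℝ} {m : ℕ} (𝒬 : Finset (Set (EuclideanSpace ℝ (Fin n))))
    (hocc : ∀ c, ∀ P ∈ 𝒬, ∃ x ∈ X ∩ Metric.closedBall c m, centredPatch X x T = P)
    (S : EuclideanSpace ℝ (Fin n) → Prop) [DecidablePred S]
    (hS : ∀ P ∈ 𝒬, ∀ x ∈ X, centredPatch X x T = P → ∀ p, ‖p - x‖ ≤ n → S p)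
    (y : EuclideanSpace ℝ (Fin n)) :
    𝒬.card ≤ C₀ * ((gridCube n m).filter fun κ => S (y + κ)).card := by
  classical
  choose! x hx hxP using hocc y
  have hround : ∀ P ∈ 𝒬, ∃ κ ∈ gridCube n m, ‖x P - y - κ‖ ≤ n := fun P hP =>
    exists_mem_gridCube_near _ (by
      have := (hx P hP).2
      rwa [Metric.mem_closedBall, dist_eq_norm] at this)
  choose! κ hκ hκn using hround
  refine Finset.card_le_mul_card_image_of_maps_to (f := κ) (fun P hP => ?_) C₀ fun k _ => ?_
  · refine Finset.mem_filter.2 ⟨hκ P hP, hS P hP (x P) (hx P hP).1 (hxP P hP) _ ?_⟩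
    rw [norm_sub_rev, ← sub_sub]
    exact hκn P hP
  · rcases Finset.eq_empty_or_nonempty (𝒬.filter fun P => κ P = k) with h0 | ⟨P₀, hP₀⟩
    · rw [h0]
      simp
    · refine le_trans ?_ hC₀
      rw [← Set.ncard_coe_finset]
      refine Set.ncard_le_ncard_of_injOn (fun P => x P - x P₀) (fun P hP => ?_)
        (fun P hP P' hP' h => ?_) hfin
      · have hP1 := Finset.mem_filter.1 (Finset.mem_coe.1 hP)
        have hP2 := Finset.mem_filter.1 hP₀
        refine ⟨Set.sub_mem_sub (hx P hP1.1).1 (hx P₀ hP2.1).1, ?_⟩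
        rw [mem_closedBall_zero_iff]
        have h1 := hκn P hP1.1
        have h2 := hκn P₀ hP2.1
        rw [hP1.2] at h1
        rw [hP2.2] at h2
        have h3 := norm_sub_le (x P - y - k) (x P₀ - y - k)
        rw [sub_sub_sub_cancel_right, sub_sub_sub_cancel_right] at h3
        linarith
      · have hP1 := Finset.mem_filter.1 (Finset.mem_coe.1 hP)
        have hP2 := Finset.mem_filter.1 (Finset.mem_coe.1 hP')
        have h1 : x P = x P' := sub_left_injective h
        rw [← hxP P hP1.1, ← hxP P' hP2.1, h1]

end Grid

section Dense

variable {n : ℕ} {X : Set (EuclideanSpace ℝ (Fin n))}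

lemma IsCoarseExtension.neg {E : Type*} [NormedAddCommGroup E] {X : Set E} {f F : E → ℝ} {R A : ℝ}
    (hF : IsCoarseExtension X f F R A) :
    IsCoarseExtension X (fun x => -f x) (fun x => -F x) R A where
  nonneg := hF.nonneg
  lipschitz p q := by
    rw [← abs_neg]
    convert hF.lipschitz p q using 2
    ring
  near x hx := by
    rw [← abs_neg]
    convert hF.near x hx using 2
    ring
  patch x hx x' hx' T hT u hu := by
    rw [← abs_neg]
    convert hF.patch x hx x' hx' T hT u hu using 2
    ring

/-- If at least half of the patches carry slopes at most `σ - g`, where `σ` is the maximal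
asymptotic slope, then `g` is small: these patches occur in every ball of radius `M`, which has
volume comparable to the number of all patches, so they cover a positive proportion of space. -/
lemma slope_gap_le_of_half {f F : EuclideanSpace ℝ (Fin n) → ℝ} {R A : ℝ}
    (hF : IsCoarseExtension X f F R A) {C₀ : ℕ}
    (hfin : ((X - X) ∩ Metric.closedBall 0 (2 * n)).Finite)
    (hC₀ : ((X - X) ∩ Metric.closedBall 0 (2 * n)).ncard ≤ C₀)
    {e : EuclideanSpace ℝ (Fin n)} {U : ℕ} (hU : 0 < U) {σ ε g K T M : ℝ} (hg : 0 ≤ g)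
    (hK : 0 ≤ K)
    (hup : ∀ p, F (p + U • e) - F p ≤ U * (σ + ε))
    (hlong : ∀ W : ℕ, ∃ p, W * σ - 1 ≤ F (p + W • e) - F p)
    (hUε : A * (2 * n + 3) ≤ U * ε)
    (hT : U * ‖e‖ + R ≤ T) (hM1 : 1 ≤ M) (hM : IsRepetitivityRadius X T M)
    (hMN : M ^ n ≤ K * patchCount X T)
    (𝒬 : Finset (Set (EuclideanSpace ℝ (Fin n)))) (hhalf : patchCount X T ≤ 2 * 𝒬.card)
    (hlow : ∀ P ∈ 𝒬, ∃ x ∈ X, P = centredPatch X x T ∧ F (x + U • e) - F x ≤ U * (σ - g)) :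
    g ≤ (5 ^ n * K * 2 * C₀) * ε := by
  classical
  set m : ℕ := ⌈M⌉₊ with hm
  have hA := hF.nonneg
  refine slope_gap_le hF.lipschitz hU hg (by positivity) (gridCube_nonempty n m) hup hlong
    fun y => ?_
  have h1 := card_patches_le hfin hC₀ (T := T) (m := m) 𝒬
    (fun c P hP => by
      obtain ⟨x, hx, hxP, -⟩ := hlow P hP
      obtain ⟨x', ⟨hx', hxc⟩, h⟩ := hM c P ⟨x, hx, hxP⟩
      exact ⟨x', ⟨hx', Metric.closedBall_subset_closedBall (Nat.le_ceil M) hxc⟩, h⟩)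
    (fun p => F (p + U • e) - F p ≤ U * (σ + ε - g))
    (fun P hP x' hx' hx'P p hp => by
      obtain ⟨x, hx, hxP, hslope⟩ := hlow P hP
      have h2 := (abs_le.1 (hF.patch x' hx' x hx T (hx'P.trans hxP) (U • e) (by
        linarith [nsmul_norm_le U e]))).2
      have h3 := (abs_le.1 (hF.lipschitz (p + U • e) (x' + U • e))).2
      have h4 := (abs_le.1 (hF.lipschitz p x')).1
      rw [add_sub_add_right_eq_sub] at h3
      have h5 : A * (‖p - x'‖ + 1) ≤ A * (n + 1) := by gcongr
      linarith) y
  set L : ℕ := ((gridCube n m).filter fun κ =>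
    F (y + κ + U • e) - F (y + κ) ≤ U * (σ + ε - g)).card with hL
  have h2 : ((gridCube n m).card : ℝ) ≤ (2 * m + 1) ^ n := by
    exact_mod_cast card_gridCube_le n m
  have h3 : (m : ℝ) < M + 1 := Nat.ceil_lt_add_one (by linarith)
  have h4 : (2 * m + 1 : ℝ) ^ n ≤ (5 * M) ^ n := by
    gcongr
    linarith
  have h5 : (patchCount X T : ℝ) ≤ 2 * (C₀ * L) := by exact_mod_cast hhalf.trans (by omega)
  calc ((gridCube n m).card : ℝ) ≤ (5 * M) ^ n := h2.trans h4
    _ = 5 ^ n * M ^ n := mul_pow _ _ _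
    _ ≤ 5 ^ n * (K * (2 * (C₀ * L))) := by
      gcongr
      exact hMN.trans (by gcongr)
    _ = _ := by ring

/-- Dense repetitivity as a comparison of the volume of a repetitivity ball with the number of
patches. The radius exceeds the infimum `M_X(T)` by one, so that it is a repetitivity radius. -/
lemma IsDenselyRepetitive.exists_radius (hX : IsDenselyRepetitive X) (hn : 0 < n)
    (hne : X.Nonempty) :
    ∃ K T₀ : ℝ, 0 ≤ K ∧ ∀ T, T₀ ≤ T → ∃ M, 1 ≤ M ∧ IsRepetitivityRadius X T M ∧
      M ^ n ≤ K * patchCount X T := by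
  obtain ⟨hfin, hrep, hO⟩ := hX
  obtain ⟨c, hc0, hc⟩ := hO.exists_nonneg
  obtain ⟨T₀, hT₀⟩ := eventually_atTop.1 hc.bound
  refine ⟨(c + 1) ^ n, max T₀ 1, by positivity, fun T hT => ⟨repetitivity X T + 1, ?_, ?_, ?_⟩⟩
  · linarith [repetitivity_nonneg X T]
  · exact isRepetitivityRadius_add_one hrep (by linarith [le_max_right T₀ 1])
  · have h1 := hT₀ T ((le_max_left _ _).trans hT)
    have hN : 1 ≤ patchCount X T := by
      obtain ⟨x, hx⟩ := hne
      exact (Set.ncard_pos (hfin.finite_atlas T)).2 ⟨_, x, hx, rfl⟩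
    have hN' : (1 : ℝ) ≤ patchCount X T := by exact_mod_cast hN
    have h2 : (1 : ℝ) ≤ (patchCount X T : ℝ) ^ (1 / (n : ℝ)) :=
      Real.one_le_rpow hN' (by positivity)
    rw [Real.norm_of_nonneg (repetitivity_nonneg _ _), Real.norm_of_nonneg (by positivity)] at h1
    have h3 : repetitivity X T + 1 ≤ (c + 1) * (patchCount X T : ℝ) ^ (1 / (n : ℝ)) := by
      linarith
    have h4 : ((patchCount X T : ℝ) ^ (1 / (n : ℝ))) ^ n = patchCount X T := by
      rw [one_div]
      exact Real.rpow_inv_natCast_pow (by positivity) hn.ne'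
    calc (repetitivity X T + 1) ^ n ≤ ((c + 1) * (patchCount X T : ℝ) ^ (1 / (n : ℝ))) ^ n := by
          have := repetitivity_nonneg X T
          gcongr
      _ = _ := by rw [mul_pow, h4]

/-- Dense repetitivity forces the maximal and the minimal asymptotic slope of `F` in any direction
to agree. Otherwise call a patch low or high according to its slope over a long fixed length; one of
the two kinds makes up at least half of all patches, and so occupies a positive proportion of any
nearly extremal tube of the opposite kind. -/
lemma IsDenselyRepetitive.exists_oscBound (hX : IsDenselyRepetitive X) (hn : 0 < n)
    (hne : X.Nonempty) {f F : EuclideanSpace ℝ (Fin n) → ℝ} {R A : ℝ}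
    (hF : IsCoarseExtension X f F R A) (e : EuclideanSpace ℝ (Fin n)) {ε : ℝ} (hε : 0 < ε) :
    ∃ U : ℕ, 0 < U ∧ OscBound F (U • e) (ε * U) := by
  classical
  obtain ⟨σ, hσ, hσ'⟩ := exists_asymptotic_slope hF.lipschitz e
  obtain ⟨τ, hτ, hτ'⟩ := exists_asymptotic_slope hF.neg.lipschitz e
  rcases le_or_gt (σ + τ) (ε / 2) with hle | hgap
  · obtain ⟨U, ⟨h1, h2⟩, hU⟩ := (((hσ (ε / 4) (by positivity)).and
      (hτ (ε / 4) (by positivity))).and (eventually_gt_atTop 0)).exists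
    refine ⟨U, hU, fun p q => ?_⟩
    have h3 := h1 p
    have h4 := h2 q
    have hU' : (0 : ℝ) < U := by exact_mod_cast hU
    nlinarith
  · exfalso
    obtain ⟨K, T₀, hK, hrad⟩ := hX.exists_radius hn hne
    have hfin := hX.1.finite_differences (2 * n)
    set C₀ := ((X - X) ∩ Metric.closedBall 0 (2 * n)).ncard with hC₀
    set D : ℝ := 5 ^ n * K * 2 * C₀ with hD
    have hD0 : 0 ≤ D := by positivity
    set g : ℝ := (σ + τ) / 2 with hg
    have hg0 : 0 < g := by rw [hg]; linarith
    set η : ℝ := g / (2 * (D + 1)) with hη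
    have hη0 : 0 < η := by positivity
    have hDη : D * η < g := by
      rw [hη, mul_div_assoc', div_lt_iff₀ (by positivity)]
      nlinarith
    obtain ⟨U, ⟨⟨h1, h2⟩, hUA⟩, hU⟩ := ((((hσ η hη0).and (hτ η hη0)).and
      (eventually_ge_atTop ⌈A * (2 * n + 3) / η⌉₊)).and (eventually_gt_atTop 0)).exists
    have hUη : A * (2 * n + 3) ≤ U * η := by
      have := (Nat.le_ceil _).trans (Nat.cast_le (α := ℝ).2 hUA)
      rwa [div_le_iff₀ hη0] at this
    set T : ℝ := max T₀ (U * ‖e‖ + R) with hT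
    obtain ⟨M, hM1, hM, hMN⟩ := hrad T (le_max_left _ _)
    have hat := hX.1.finite_atlas T
    set 𝒜 := hat.toFinset with h𝒜
    have hcount : patchCount X T = 𝒜.card := Set.ncard_eq_toFinset_card _ hat
    set low : Finset _ := 𝒜.filter fun P =>
      ∃ x ∈ X, P = centredPatch X x T ∧ F (x + U • e) - F x ≤ U * (σ - g) with hlow
    set high : Finset _ := 𝒜.filter fun P =>
      ∃ x ∈ X, P = centredPatch X x T ∧ -F (x + U • e) - -F x ≤ U * (τ - g) with hhigh
    -- `σ - g` and `g - τ` are the same number, the midpoint of the two extreme slopes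
    have hcover : 𝒜 ⊆ low ∪ high := by
      intro P hP
      obtain ⟨x, hx, hxP⟩ := (Set.Finite.mem_toFinset hat).1 hP
      rw [Finset.mem_union]
      rcases le_total (F (x + U • e) - F x) (U * (σ - g)) with h | h
      · exact Or.inl (Finset.mem_filter.2 ⟨hP, x, hx, hxP, h⟩)
      · refine Or.inr (Finset.mem_filter.2 ⟨hP, x, hx, hxP, ?_⟩)
        have : U * (τ - g) = -(U * (σ - g)) := by
          rw [hg]
          ring
        linarith
    have hcard : 𝒜.card ≤ low.card + high.card :=
      (Finset.card_le_card hcover).trans (Finset.card_union_le _ _)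
    rcases le_total high.card low.card with h | h
    · have := slope_gap_le_of_half (T := T) hF hfin le_rfl hU hg0.le hK h1 hσ' hUη (le_max_right _ _)
        hM1 hM hMN low (by omega) fun P hP => (Finset.mem_filter.1 hP).2
      linarith
    · have := slope_gap_le_of_half (T := T) hF.neg hfin le_rfl hU hg0.le hK
        h2 hτ' hUη (le_max_right _ _) hM1 hM hMN high (by omega) fun P hP => (Finset.mem_filter.1 hP).2
      linarith

end Dense

/-! ### Linear approximation of the address map -/

section Assembly

variable {n : ℕ} {X : Set (EuclideanSpace ℝ (Fin n))}

/-- Oscillation bounds along the coordinate directions combine to a bound in all directions. -/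
lemma oscBound_of_directions {F : EuclideanSpace ℝ (Fin n) → ℝ} {A : ℝ}
    (hF : ∀ p q, |F p - F q| ≤ A * (‖p - q‖ + 1))
    (hdir : ∀ (i : Fin n), ∀ ε > 0, ∃ U : ℕ, 0 < U ∧
      OscBound F (U • EuclideanSpace.single i (1 : ℝ)) (ε * U)) :
    ∀ ε > 0, ∃ C, ∀ v, OscBound F v (ε * ‖v‖ + C) := by
  have hA : 0 ≤ A := by simpa using hF 0 0
  intro ε hε
  set η : ℝ := ε / (n + 1) with hη
  have hη0 : 0 < η := by positivity
  choose U hU hUosc using fun i => hdir i η hη0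
  set D : Fin n → ℝ := fun i => 2 * (A * (U i + 1)) with hD
  have hcoord : ∀ (i : Fin n) (t : ℝ),
      OscBound F (EuclideanSpace.single i t) (η * |t| + D i) := by
    intro i t
    have hU' : (0 : ℝ) < U i := by exact_mod_cast hU i
    -- reduce to `t ≥ 0` by symmetry
    wlog ht : 0 ≤ t generalizing t
    · have h1 := (this (-t) (by linarith)).neg
      rw [abs_neg] at h1
      convert h1 using 1
      ext j
      by_cases h : j = i <;> simp [h]
    rw [abs_of_nonneg ht]
    set k : ℕ := ⌊t / U i⌋₊ with hk
    have hk1 : k * U i ≤ t := by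
      have := Nat.floor_le (div_nonneg ht hU'.le)
      rwa [le_div_iff₀ hU'] at this
    have hk2 : t < (k + 1) * U i := by
      have := Nat.lt_floor_add_one (t / U i)
      rwa [div_lt_iff₀ hU'] at this
    set r : ℝ := t - k * U i with hr
    have h1 : OscBound F (EuclideanSpace.single i r) (D i) := by
      intro p q
      have h2 := (abs_le.1 (hF (p + EuclideanSpace.single i r) p)).2
      have h3 := (abs_le.1 (hF (q + EuclideanSpace.single i r) q)).1
      have h4 : ‖EuclideanSpace.single i r‖ ≤ U i := by
        rw [PiLp.norm_single, Real.norm_of_nonneg (by rw [hr]; linarith)]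
        linarith
      rw [add_sub_cancel_left] at h2 h3
      have h5 : A * (‖EuclideanSpace.single i r‖ + 1) ≤ A * (U i + 1) := by gcongr
      simp only [hD]
      linarith
    have h2 := ((hUosc i).nsmul k).add h1
    have h3 : k • U i • EuclideanSpace.single i (1 : ℝ) + EuclideanSpace.single i r
        = EuclideanSpace.single i t := by
      ext j
      by_cases h : j = i <;> simp [h, hr]
    rw [h3] at h2
    refine h2.mono ?_
    nlinarith
  refine ⟨∑ i, D i, fun v => ?_⟩
  have h1 := OscBound.sum Finset.univ fun i _ => hcoord i (v i)
  have h2 : ∑ i, EuclideanSpace.single i (v i) = v := by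
    ext j
    simp
  rw [h2] at h1
  refine h1.mono ?_
  rw [Finset.sum_add_distrib]
  have h3 : ∑ i, η * |v i| ≤ ∑ _i : Fin n, η * ‖v‖ := by
    refine Finset.sum_le_sum fun i _ => ?_
    have := PiLp.norm_apply_le v i
    rw [Real.norm_eq_abs] at this
    gcongr
  rw [Finset.sum_const, Finset.card_univ, Fintype.card_fin, nsmul_eq_mul] at h3
  have h4 : (n : ℝ) * (η * ‖v‖) ≤ ε * ‖v‖ := by
    have h5 : n * η ≤ ε := by
      rw [hη, mul_div_assoc', div_le_iff₀ (by positivity)]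
      nlinarith
    rw [← mul_assoc]
    gcongr
  linarith

/-- A power bound with exponent `γ < 1` is sublinear. -/
lemma exists_const_mul_rpow_le {γ C : ℝ} (hγ0 : 0 < γ) (hγ1 : γ < 1) (hC : 0 ≤ C) {ε : ℝ}
    (hε : 0 < ε) : ∃ C', ∀ t : ℝ, 0 ≤ t → C * (1 + t ^ γ) ≤ ε * t + C' := by
  have h1 : (fun t : ℝ => t ^ γ) =o[atTop] fun t : ℝ => t := by
    refine (isLittleO_iff_tendsto' ?_).2 ?_
    · filter_upwards [eventually_gt_atTop 0] with t ht h
      exact absurd h ht.ne'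
    · refine (tendsto_rpow_neg_atTop (sub_pos.2 hγ1)).congr' ?_
      filter_upwards [eventually_gt_atTop 0] with t ht
      rw [neg_sub, Real.rpow_sub_one ht.ne']
  have h2 := h1.def (show 0 < ε / (C + 1) by positivity)
  obtain ⟨T, hT⟩ := eventually_atTop.1 h2
  set T' := max T 0 with hT'
  refine ⟨C * (1 + T' ^ γ), fun t ht => ?_⟩
  have hT0 : 0 ≤ T' := le_max_right _ _
  have hTγ : 0 ≤ T' ^ γ := by positivity
  rcases le_total t T' with h | h
  · have h3 : t ^ γ ≤ T' ^ γ := Real.rpow_le_rpow ht h hγ0.le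
    have h4 : C * (1 + t ^ γ) ≤ C * (1 + T' ^ γ) := by gcongr
    have : 0 ≤ ε * t := by positivity
    linarith
  · have h3 := hT t ((le_max_left _ _).trans h)
    rw [Real.norm_of_nonneg (by positivity), Real.norm_of_nonneg ht] at h3
    have h4 : C * t ^ γ ≤ C * (ε / (C + 1) * t) := by gcongr
    have h5 : C * (ε / (C + 1) * t) ≤ ε * t := by
      rw [← mul_assoc]
      refine mul_le_mul_of_nonneg_right ?_ ht
      rw [mul_div_assoc', div_le_iff₀ (by positivity)]
      nlinarith
    have h6 : 0 ≤ C * T' ^ γ := by positivity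
    linarith

lemma IsFiniteType.exists_min_norm {E : Type*} [NormedAddCommGroup E] {X : Set E}
    (hX : IsFiniteType X) (h0 : (0 : E) ∈ X) : ∃ r : ℝ, 0 < r ∧ ∀ x ∈ X, x ≠ 0 → r ≤ ‖x‖ := by
  have hfin := (hX.finite_differences 1).subset
    (show (X ∩ Metric.closedBall 0 1) \ {0} ⊆ _ from fun x hx =>
      ⟨⟨x, hx.1.1, 0, h0, sub_zero x⟩, hx.1.2⟩)
  rcases ((X ∩ Metric.closedBall 0 1) \ {0}).eq_empty_or_nonempty with he | hne
  · refine ⟨1, one_pos, fun x hx hx0 => ?_⟩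
    by_contra! h
    have : x ∈ (X ∩ Metric.closedBall 0 1) \ {0} := ⟨⟨hx, by simpa using h.le⟩, hx0⟩
    rw [he] at this
    exact this
  · obtain ⟨y, hy, hmin⟩ := Set.exists_min_image _ (fun x => ‖x‖) hfin hne
    refine ⟨min 1 ‖y‖, lt_min one_pos (norm_pos_iff.2 hy.2), fun x hx hx0 => ?_⟩
    rcases le_total ‖x‖ 1 with h | h
    · exact (min_le_right _ _).trans (hmin x ⟨⟨hx, by simpa using h⟩, hx0⟩)
    · exact (min_le_left _ _).trans h

/-- As bounded parts of `X` are finite, the little-o condition at infinity is a bound on all of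
`X`. -/
lemma isAsymptoticLinearMap_iff {E : Type*} [NormedAddCommGroup E] [Module ℝ E] {X : Set E} {s : ℕ}
    (hX : IsFiniteType X) (h0 : (0 : E) ∈ X)
    (φ : AddSubgroup.closure X ≃+ (Fin s → ℤ)) (L : E →ₗ[ℝ] EuclideanSpace ℝ (Fin s)) :
    IsAsymptoticLinearMap φ L ↔
      ∀ ε > 0, ∃ C, ∀ x : X, ‖address φ x - L x.1‖ ≤ ε * ‖x.1‖ + C := by
  unfold IsAsymptoticLinearMap
  rw [isLittleO_iff]
  constructor
  · intro h ε hε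
    have h1 := h hε
    rw [eventually_comap, eventually_atTop] at h1
    obtain ⟨T, hT⟩ := h1
    -- finitely many points of `X` lie in the ball of radius `T`
    have hfin : {x : X | ‖x.1‖ ≤ T}.Finite := by
      refine Set.Finite.of_finite_image ((hX.finite_differences T).subset ?_)
        Subtype.val_injective.injOn
      rintro _ ⟨x, hx, rfl⟩
      exact ⟨⟨x.1, x.2, 0, h0, sub_zero _⟩, by simpa using hx⟩
    obtain ⟨C, hC⟩ := (hfin.image fun x => ‖address φ x - L x.1‖).bddAbove
    refine ⟨max C 0, fun x => ?_⟩
    have hx0 : 0 ≤ ε * ‖x.1‖ := by positivity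
    rcases le_total ‖x.1‖ T with hx | hx
    · have := hC ⟨x, hx, rfl⟩
      linarith [le_max_left C 0]
    · have := hT _ hx x rfl
      rw [norm_norm, norm_norm] at this
      linarith [le_max_right C 0]
  · intro h c hc
    obtain ⟨C, hC⟩ := h (c / 2) (by positivity)
    rw [eventually_comap]
    filter_upwards [eventually_ge_atTop (2 * C / c)] with t ht x hx
    rw [norm_norm, norm_norm]
    have h1 := hC x
    rw [← hx, div_le_iff₀ hc] at ht
    linarith

lemma IsAsymptoticLinearMap.unique {E : Type*} [NormedAddCommGroup E] [NormedSpace ℝ E]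
    {X : Set E} {s : ℕ} (hX : IsFiniteType X) (h0 : (0 : E) ∈ X) [FiniteDimensional ℝ E]
    {φ : AddSubgroup.closure X ≃+ (Fin s → ℤ)} {L L' : E →ₗ[ℝ] EuclideanSpace ℝ (Fin s)}
    (hL : IsAsymptoticLinearMap φ L) (hL' : IsAsymptoticLinearMap φ L') : L = L' := by
  rw [isAsymptoticLinearMap_iff hX h0] at hL hL'
  obtain ⟨R, hR0, hR⟩ := hX.exists_covering
  set D : E →L[ℝ] EuclideanSpace ℝ (Fin s) := LinearMap.toContinuousLinearMap (L - L') with hD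
  have hDx : ∀ x, D x = L x - L' x := fun x => rfl
  have hsmall : ∀ ε > 0, ∀ v, ‖D v‖ ≤ ε * ‖v‖ := by
    intro ε hε v
    obtain ⟨C, hC⟩ := hL (ε / 2) (by positivity)
    obtain ⟨C', hC'⟩ := hL' (ε / 2) (by positivity)
    set K : ℝ := ε * R + C + C' + ‖D‖ * R with hK
    have hbound : ∀ k : ℕ, 0 < k → ‖D v‖ ≤ ε * ‖v‖ + K / k := by
      intro k hk
      have hk' : (0 : ℝ) < k := by exact_mod_cast hk
      obtain ⟨x, hx, hxk⟩ := hR ((k : ℝ) • v)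
      have h1 := hC ⟨x, hx⟩
      have h2 := hC' ⟨x, hx⟩
      have h3 : ‖D x‖ ≤ ε * ‖x‖ + C + C' := by
        have e : D x = (address φ ⟨x, hx⟩ - L' x) - (address φ ⟨x, hx⟩ - L x) := by
          rw [hDx]
          abel
        rw [e]
        refine (norm_sub_le _ _).trans ?_
        simp only at h1 h2
        linarith
      have h4 : ‖x‖ ≤ k * ‖v‖ + R := by
        have := norm_add_le (x - (k : ℝ) • v) ((k : ℝ) • v)
        rw [sub_add_cancel, norm_smul, Real.norm_natCast] at this
        linarith
      have h5 : ‖D (x - (k : ℝ) • v)‖ ≤ ‖D‖ * R := (D.le_opNorm _).trans (by gcongr)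
      have h6 : k * ‖D v‖ ≤ ‖D x‖ + ‖D‖ * R := by
        have e : D ((k : ℝ) • v) = D x - D (x - (k : ℝ) • v) := by
          rw [← map_sub, sub_sub_cancel]
        have h7 : ‖D ((k : ℝ) • v)‖ = k * ‖D v‖ := by
          rw [map_smul, norm_smul, Real.norm_natCast]
        rw [← h7, e]
        exact (norm_sub_le _ _).trans (by gcongr)
      have h8 : ε * ‖x‖ ≤ ε * (k * ‖v‖ + R) := by gcongr
      rw [← sub_le_iff_le_add', le_div_iff₀ hk', hK]
      nlinarith
    have hlim : Tendsto (fun k : ℕ => ε * ‖v‖ + K / k) atTop (nhds (ε * ‖v‖ + 0)) :=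
      tendsto_const_nhds.add (tendsto_const_div_atTop_nhds_zero_nat K)
    rw [add_zero] at hlim
    refine ge_of_tendsto hlim ?_
    filter_upwards [eventually_gt_atTop 0] with k hk
    exact hbound k hk
  ext1 v
  have h1 : ‖D v‖ ≤ 0 := by
    refine le_of_forall_pos_le_add fun ε hε => ?_
    refine (hsmall (ε / (‖v‖ + 1)) (by positivity) v).trans ?_
    rw [div_mul_eq_mul_div, div_le_iff₀ (by positivity)]
    nlinarith [norm_nonneg v]
  rw [norm_le_zero_iff, hDx] at h1
  exact sub_eq_zero.1 h1

open scoped Classical in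
/-- The `i`-th coordinate of the address, extended by zero outside the group generated by `X`. -/
noncomputable def addressCoord {E : Type*} [NormedAddCommGroup E] {X : Set E} {s : ℕ}
    (φ : AddSubgroup.closure X ≃+ (Fin s → ℤ)) (i : Fin s) (x : E) : ℝ :=
  if h : x ∈ AddSubgroup.closure X then (φ ⟨x, h⟩ i : ℝ) else 0

lemma addressCoord_sub {E : Type*} [NormedAddCommGroup E] {X : Set E} {s : ℕ}
    (φ : AddSubgroup.closure X ≃+ (Fin s → ℤ)) (i : Fin s) (a : E) (ha : a ∈ X) (b : E)
    (hb : b ∈ X) :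
    addressCoord φ i (a - b) = addressCoord φ i a - addressCoord φ i b := by
  have ha' : a ∈ AddSubgroup.closure X := AddSubgroup.subset_closure ha
  have hb' : b ∈ AddSubgroup.closure X := AddSubgroup.subset_closure hb
  have hab := AddSubgroup.sub_mem _ ha' hb'
  have h1 : (⟨a - b, hab⟩ : AddSubgroup.closure X) = ⟨a, ha'⟩ - ⟨b, hb'⟩ := rfl
  rw [addressCoord, addressCoord, addressCoord, dif_pos ha', dif_pos hb', dif_pos hab, h1, map_sub]
  simp

lemma address_apply {E : Type*} [NormedAddCommGroup E] {X : Set E} {s : ℕ}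
    (φ : AddSubgroup.closure X ≃+ (Fin s → ℤ)) (x : X) (i : Fin s) :
    address φ x i = addressCoord φ i x.1 := by
  have hx : x.1 ∈ AddSubgroup.closure X := AddSubgroup.subset_closure x.2
  rw [addressCoord, dif_pos hx]
  rfl

/-- If all coarse extensions of functions have sublinear oscillation, then the address map is
approximated by a linear map, with an error controlled by the oscillation of the extensions of its
coordinates. -/
lemma exists_linearMap_near_address {E : Type*} [NormedAddCommGroup E] [NormedSpace ℝ E]
    {X : Set E} {R : ℝ} (hX : IsFiniteType X) (hR : ∀ p : E, ∃ x ∈ X, ‖x - p‖ ≤ R)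
    (hosc : ∀ (f F : E → ℝ) (A : ℝ), IsCoarseExtension X f F R A →
      ∀ ε > 0, ∃ C, ∀ v, OscBound F v (ε * ‖v‖ + C))
    {s : ℕ} (φ : AddSubgroup.closure X ≃+ (Fin s → ℤ)) :
    ∃ (L : E →ₗ[ℝ] EuclideanSpace ℝ (Fin s)) (f F : Fin s → E → ℝ) (A : Fin s → ℝ) (K : ℝ),
      (∀ i, IsCoarseExtension X (f i) (F i) R (A i)) ∧ 0 ≤ K ∧
      ∀ (x : X) (ω : ℝ), (∀ i, OscBound (F i) x.1 ω) →
        ‖address φ x - L x.1‖ ≤ s * (ω + K) := by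
  choose F A hFA using fun i => exists_isCoarseExtension hR hX (f := addressCoord φ i)
    (addressCoord_sub φ i)
  choose l hl using fun i =>
    exists_linearMap_of_oscBound (hFA i).lipschitz (hosc _ _ _ (hFA i))
  have hnn : ∀ i, 0 ≤ A i + |F i 0| := fun i => add_nonneg (hFA i).nonneg (abs_nonneg _)
  refine ⟨(WithLp.linearEquiv 2 ℝ (Fin s → ℝ)).symm.toLinearMap ∘ₗ LinearMap.pi l,
    _, F, A, ∑ i, (A i + |F i 0|), hFA, Finset.sum_nonneg fun i _ => hnn i, fun x ω hω => ?_⟩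
  refine (norm_le_sum_abs _).trans ?_
  have h1 : (s : ℝ) * (ω + ∑ i, (A i + |F i 0|))
      = ∑ _i : Fin s, (ω + ∑ i, (A i + |F i 0|)) := by
    rw [Finset.sum_const, Finset.card_univ, Fintype.card_fin, nsmul_eq_mul]
  rw [h1]
  refine Finset.sum_le_sum fun i _ => ?_
  have h2 : A i + |F i 0| ≤ ∑ i, (A i + |F i 0|) :=
    Finset.single_le_sum (f := fun i => A i + |F i 0|) (fun i _ => hnn i) (Finset.mem_univ i)
  have h3 := abs_le.1 ((hFA i).near x.1 x.2)
  have h4 := abs_le.1 (hl i x.1 ω (hω i))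
  have h5 := le_abs_self (F i 0)
  have h6 := neg_abs_le (F i 0)
  rw [PiLp.sub_apply, address_apply]
  change |addressCoord φ i x.1 - l i x.1| ≤ _
  rw [abs_le]
  constructor <;> linarith [h3.1, h3.2, h4.1, h4.2]

lemma exists_isAsymptoticLinearMap {E : Type*} [NormedAddCommGroup E] [NormedSpace ℝ E]
    {X : Set E} {R : ℝ} (hX : IsFiniteType X) (h0 : (0 : E) ∈ X)
    (hR : ∀ p : E, ∃ x ∈ X, ‖x - p‖ ≤ R)
    (hosc : ∀ (f F : E → ℝ) (A : ℝ), IsCoarseExtension X f F R A →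
      ∀ ε > 0, ∃ C, ∀ v, OscBound F v (ε * ‖v‖ + C))
    {s : ℕ} (φ : AddSubgroup.closure X ≃+ (Fin s → ℤ)) :
    ∃ L : E →ₗ[ℝ] EuclideanSpace ℝ (Fin s), IsAsymptoticLinearMap φ L := by
  obtain ⟨L, f, F, A, K, hF, -, hL⟩ := exists_linearMap_near_address hX hR hosc φ
  refine ⟨L, (isAsymptoticLinearMap_iff hX h0 φ L).2 fun ε hε => ?_⟩
  have hε' : 0 < ε / (s + 1) := by positivity
  choose C hC using fun i => hosc _ _ _ (hF i) _ hε'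
  have hC0 : ∀ i, 0 ≤ C i := fun i => by simpa using (hC i 0).nonneg
  refine ⟨s * (∑ i, C i + K), fun x => ?_⟩
  refine (hL x (ε / (s + 1) * ‖x.1‖ + ∑ i, C i) fun i => (hC i x.1).mono ?_).trans ?_
  · have := Finset.single_le_sum (f := C) (fun i _ => hC0 i) (Finset.mem_univ i)
    linarith
  · have h1 : s * (ε / (s + 1)) ≤ ε := by
      rw [mul_div_assoc', div_le_iff₀ (by positivity)]
      nlinarith
    have h2 := mul_le_mul_of_nonneg_right h1 (norm_nonneg x.1)
    linarith

/-- For a linearly repetitive set the oscillation has a power saving, with an exponent that depends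
only on the set. -/
lemma IsLinearlyRepetitive.exists_exponent (hX : IsLinearlyRepetitive X) {R : ℝ}
    (hR0 : 0 < R) (hR : ∀ p : EuclideanSpace ℝ (Fin n), ∃ x ∈ X, ‖x - p‖ ≤ R) :
    ∃ γ : ℝ, 0 < γ ∧ γ < 1 ∧ ∀ (f F : EuclideanSpace ℝ (Fin n) → ℝ) (A : ℝ),
      IsCoarseExtension X f F R A → ∃ C : ℝ, 0 ≤ C ∧ ∀ v, OscBound F v (C * (1 + ‖v‖ ^ γ)) := by
  obtain ⟨B, t₀, ht₀, hrec⟩ := hX.increments_recur hR0 hR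
  obtain ⟨γ, hγ0, hγ1, h⟩ := exists_exponent_of_increments_recur
    (E := EuclideanSpace ℝ (Fin n)) B
  refine ⟨γ, hγ0, hγ1, fun f F A hF => h F (2 * A) t₀ ht₀ (fun p q => ?_) (hrec f F A hF)⟩
  have := hF.nonneg
  refine (hF.lipschitz p q).trans ?_
  gcongr
  linarith

lemma sublinear_oscillation_of_exponent {E : Type*} [NormedAddCommGroup E] {F : E → ℝ} {γ : ℝ}
    (hγ0 : 0 < γ) (hγ1 : γ < 1)
    (hF : ∃ C : ℝ, 0 ≤ C ∧ ∀ v, OscBound F v (C * (1 + ‖v‖ ^ γ))) :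
    ∀ ε > 0, ∃ C, ∀ v, OscBound F v (ε * ‖v‖ + C) := by
  intro ε hε
  obtain ⟨C, hC, hosc⟩ := hF
  obtain ⟨C', hC'⟩ := exists_const_mul_rpow_le hγ0 hγ1 hC hε
  exact ⟨C', fun v => (hosc v).mono (hC' _ (norm_nonneg v))⟩

lemma exists_isAsymptoticLinearMap_rate {E : Type*} [NormedAddCommGroup E] [NormedSpace ℝ E]
    {X : Set E} {R : ℝ} (hX : IsFiniteType X) (h0 : (0 : E) ∈ X)
    (hR : ∀ p : E, ∃ x ∈ X, ‖x - p‖ ≤ R) {γ : ℝ} (hγ0 : 0 < γ) (hγ1 : γ < 1)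
    (hosc : ∀ (f F : E → ℝ) (A : ℝ), IsCoarseExtension X f F R A →
      ∃ C : ℝ, 0 ≤ C ∧ ∀ v, OscBound F v (C * (1 + ‖v‖ ^ γ)))
    {s : ℕ} (φ : AddSubgroup.closure X ≃+ (Fin s → ℤ)) :
    ∃ L : E →ₗ[ℝ] EuclideanSpace ℝ (Fin s), IsAsymptoticLinearMap φ L ∧
      ∃ C : ℝ, ∀ x : X, ‖address φ x - L x.1‖ ≤ C * ‖x.1‖ ^ γ := by
  have hsub := fun f F A hF =>
    sublinear_oscillation_of_exponent hγ0 hγ1 (hosc f F A hF)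
  obtain ⟨L, f, F, A, K, hF, hK, hL⟩ := exists_linearMap_near_address hX hR hsub φ
  choose C hC0 hC using fun i => hosc _ _ _ (hF i)
  obtain ⟨r, hr, hmin⟩ := hX.exists_min_norm h0
  have hrγ : 0 < r ^ γ := by positivity
  set S : ℝ := ∑ i, C i with hS
  have hS0 : 0 ≤ S := Finset.sum_nonneg fun i _ => hC0 i
  have hb : ∀ x : X, ‖address φ x - L x.1‖ ≤ s * (S * (1 + ‖x.1‖ ^ γ) + K) := by
    intro x
    refine hL x _ fun i => (hC i x.1).mono ?_
    have := Finset.single_le_sum (f := C) (fun i _ => hC0 i) (Finset.mem_univ i)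
    gcongr
  refine ⟨L, (isAsymptoticLinearMap_iff hX h0 φ L).2 fun ε hε => ?_,
    s * (S + (S + K) / r ^ γ), fun x => ?_⟩
  · obtain ⟨C', hC'⟩ := exists_const_mul_rpow_le hγ0 hγ1 (C := s * S) (by positivity) hε
    refine ⟨C' + s * K, fun x => (hb x).trans ?_⟩
    linarith [hC' _ (norm_nonneg x.1)]
  · by_cases hx : x.1 = 0
    · -- at the origin both sides vanish, as `0 ^ γ = 0`
      have hx' : x = ⟨0, h0⟩ := Subtype.ext hx
      have h1 : address φ x = 0 := by
        ext i
        have h2 := addressCoord_sub φ i 0 h0 0 h0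
        rw [sub_self, sub_self] at h2
        rw [address_apply, hx, h2]
        rfl
      rw [h1, hx, map_zero, sub_zero, norm_zero, norm_zero, Real.zero_rpow hγ0.ne', mul_zero]
    · have h1 : r ^ γ ≤ ‖x.1‖ ^ γ := Real.rpow_le_rpow hr.le (hmin _ x.2 hx) hγ0.le
      have h2 : S + K ≤ (S + K) / r ^ γ * ‖x.1‖ ^ γ := by
        rw [div_mul_eq_mul_div, le_div_iff₀ hrγ]
        gcongr
      refine (hb x).trans ?_
      rw [mul_assoc]
      refine mul_le_mul_of_nonneg_left ?_ (Nat.cast_nonneg s)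
      linarith

end Assembly

end Delone

theorem theorem7p1 {n : ℕ} (X : Set (EuclideanSpace ℝ (Fin n)))
    (h0 : (0 : EuclideanSpace ℝ (Fin n)) ∈ X)
    (hX : Delone.IsLinearlyRepetitive X ∨ Delone.IsDenselyRepetitive X) :
    (∀ (s : ℕ) (b : Module.Basis (Fin s) ℤ (AddSubgroup.closure X)),
      ∃! L : EuclideanSpace ℝ (Fin n) →ₗ[ℝ] EuclideanSpace ℝ (Fin s),
        Delone.IsAsymptoticLinearMap (Delone.addressMap b) L) ∧
    (Delone.IsLinearlyRepetitive X →
      ∃ δ : ℝ, 0 < δ ∧ δ < 1 ∧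
        ∀ (s : ℕ) (b : Module.Basis (Fin s) ℤ (AddSubgroup.closure X)),
          ∃ L : EuclideanSpace ℝ (Fin n) →ₗ[ℝ] EuclideanSpace ℝ (Fin s),
            Delone.IsAsymptoticLinearMap (Delone.addressMap b) L ∧
            ∃ C : ℝ, ∀ x : X,
              ‖Delone.address (Delone.addressMap b) x - L x.1‖ ≤ C * ‖x.1‖ ^ (1 - δ)) := by
  have hfin : Delone.IsFiniteType X := hX.elim (fun h => h.1) fun h => h.1
  obtain ⟨R, hR0, hR⟩ := hfin.exists_covering
  refine ⟨fun s b => ?_, fun hlin => ?_⟩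
  · have hosc : ∀ (f F : EuclideanSpace ℝ (Fin n) → ℝ) (A : ℝ),
        Delone.IsCoarseExtension X f F R A →
        ∀ ε > 0, ∃ C, ∀ v, Delone.OscBound F v (ε * ‖v‖ + C) := by
      intro f F A hF
      rcases hX with hlin | hdense
      · obtain ⟨γ, hγ0, hγ1, hγ⟩ := hlin.exists_exponent hR0 hR
        exact Delone.sublinear_oscillation_of_exponent hγ0 hγ1 (hγ f F A hF)
      · exact Delone.oscBound_of_directions hF.lipschitz fun i ε hε =>
          hdense.exists_oscBound i.pos ⟨0, h0⟩ hF _ hε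
    obtain ⟨L, hL⟩ := Delone.exists_isAsymptoticLinearMap hfin h0 hR hosc (Delone.addressMap b)
    exact ⟨L, hL, fun L' hL' => hL'.unique hfin h0 hL⟩
  · obtain ⟨γ, hγ0, hγ1, hγ⟩ := hlin.exists_exponent hR0 hR
    refine ⟨1 - γ, by linarith, by linarith, fun s b => ?_⟩
    rw [sub_sub_cancel]
    exact Delone.exists_isAsymptoticLinearMap_rate hfin h0 hR hγ0 hγ1 hγ (Delone.addressMap b)
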